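/- Theorem (Schur Product Theorem). A subfactor planar algebra is a spherical shaded planar $*$-algebra $\mathscr{S}=(\mathscr{S}_{n,\pm})_{n\ge 0}$ over $\mathbb{C}$ with $\dim\mathscr{S}_{n,\pm}<\infty$ for all $n$, $\dim\mathscr{S}_{0,\pm}=1$ (where $\mathscr{S}_{0,\pm}$ is identified with $\mathbb{C}$ by sending the empty diagram to $1$), and whose Markov trace induces a positive definite inner product $\langle x,y\rangle=tr(y^*x)$ on every $\mathscr{S}_{n,\pm}$. Let $\mathscr{S}$ be a subfactor planar algebra and write $\mathscr{S}_2=\mathscr{S}_{2,+}$, a $*$-algebra under vertical composition of boxes. An element of $\mathscr{S}_2$ is positive if it is of the form $a^*a$ with $a\in\mathscr{S}_2$. For $A,B\in\mathscr{S}_2$, drawn as boxes with two boundary points on the top, two on the bottom, and the distinguished (unshaded) interval on the left, the coproduct $A*B\in\mathscr{S}_2$ is obtained by placing $A$ to the left of $B$, joining the upper right point of $A$ to the upper left point of $B$ and the lower right point of $A$ to the lower left point of $B$, and taking the two left points of $A$ and the two right points of $B$ as the left and right boundary points. If $A,B\in\mathscr{S}_2$ are positive, then $A*B$ is positive. If moreover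 $\mathscr{S}$ is irreducible (that is, $\dim\mathscr{S}_{1,\pm}=1$) and $A$ and $B$ are nonzero, then $A*B$ is nonzero. -/

import Mathlib

/-!
# Shaded planar tangles and subfactor planar algebras

A planar tangle is encoded, up to orientation preserving diffeomorphism of its output disc, by its
discs, strings and regions, together with their incidences.  Planarity says that the closed oriented
surface assembled from the discs (with the complement of the output disc counted as one more disc),
the strings and the regions is a sphere.
-/

/-- The type `(n, ±)` of a box: `2 * n` boundary points, and the shading of the distinguished
boundary interval (`false` is unshaded, i.e. `+`; `true` is shaded, i.e. `-`). -/
structure BoxType where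
  n : ℕ
  shaded : Bool
  deriving DecidableEq

/-- The boundary points `0, …, 2n-1` and the boundary intervals `0, …, 2n` of a disc are numbered
clockwise; point `j` lies between the intervals `j` and `j + 1`; the intervals `0` and `2n` are the
same, namely the distinguished interval.  The shading alternates along the boundary. -/
def BoxType.shade (c : BoxType) (j : ℕ) : Bool := xor c.shaded (decide (j % 2 = 1))

namespace PlanarTangle

variable {ι : Type}

/-- The types of all the discs of a tangle: `none` is the output disc, `some i` the input disc `i`. -/
def bd (dom : ι → BoxType) (cod : BoxType) : Option ι → BoxType
  | none => cod
  | some i => dom i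

/-- All boundary points of a tangle. -/
abbrev Pt (dom : ι → BoxType) (cod : BoxType) : Type :=
  Σ d : Option ι, Fin (2 * (bd dom cod d).n)

/-- All boundary intervals of a tangle (for each disc the intervals `0` and `2n` agree). -/
abbrev Itv (dom : ι → BoxType) (cod : BoxType) : Type :=
  Σ d : Option ι, Fin (2 * (bd dom cod d).n + 1)

/-- Orient each string so that the shaded region is on its left.  Then a boundary point of an input
disc is the source of its string iff the interval before it is shaded, and a boundary point of the
output disc is the source of its string iff the interval before it is unshaded. -/
def isSource (dom : ι → BoxType) (cod : BoxType) : Pt dom cod → Bool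
  | ⟨none, j⟩ => !(cod.shade j)
  | ⟨some i, j⟩ => (dom i).shade j

/-- Consecutive pieces of the boundary circles of the regions.  The pieces are the boundary
intervals of the discs and the two sides of each string, a side of a string being named by its
shading. -/
inductive CircStep {dom : ι → BoxType} {cod : BoxType} {Str : Type}
    (endpt : Pt dom cod → Str) :
    Itv dom cod ⊕ (Str × Bool) → Itv dom cod ⊕ (Str × Bool) → Prop
  | wrap (d : Option ι) : CircStep endpt (.inl ⟨d, 0⟩) (.inl ⟨d, Fin.last _⟩)
  | before (d : Option ι) (j : Fin (2 * (bd dom cod d).n)) :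
      CircStep endpt (.inl ⟨d, j.castSucc⟩) (.inr (endpt ⟨d, j⟩, (bd dom cod d).shade j))
  | after (d : Option ι) (j : Fin (2 * (bd dom cod d).n)) :
      CircStep endpt (.inl ⟨d, j.succ⟩) (.inr (endpt ⟨d, j⟩, (bd dom cod d).shade (j + 1)))

/-- The boundary circles of the regions. -/
abbrev Circ {dom : ι → BoxType} {cod : BoxType} {Str : Type} (endpt : Pt dom cod → Str) : Type :=
  Quot (CircStep endpt)

end PlanarTangle

open PlanarTangle in
/-- A shaded planar tangle, up to isotopy, with input discs indexed by `ι`.  A string without end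
points is a closed loop. -/
structure Tangle {ι : Type} (dom : ι → BoxType) (cod : BoxType) where
  /-- the strings, closed loops included -/
  Str : Type
  /-- the regions, i.e. the connected components of the complement of discs and strings -/
  Reg : Type
  finite_str : Finite Str
  finite_reg : Finite Reg
  /-- the string that ends at a given boundary point -/
  endpt : Pt dom cod → Str
  /-- the region on the unshaded (`false`) and on the shaded (`true`) side of a string -/
  side : Str → Bool → Reg
  /-- the region that touches a given boundary interval -/
  intv : Itv dom cod → Reg
  /-- whether a region is shaded -/
  shade : Reg → Bool
  shade_side : ∀ s b, shade (side s b) = b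
  shade_intv : ∀ d j, shade (intv ⟨d, j⟩) = (bd dom cod d).shade j
  /-- a string that is not a closed loop has exactly one source and exactly one target -/
  endpt_inj : ∀ p q, endpt p = endpt q → isSource dom cod p = isSource dom cod q → p = q
  endpt_pair : ∀ p, ∃ q, endpt q = endpt p ∧ isSource dom cod q ≠ isSource dom cod p
  intv_wrap : ∀ d, intv ⟨d, 0⟩ = intv ⟨d, Fin.last _⟩
  intv_before : ∀ d j, intv ⟨d, j.castSucc⟩ = side (endpt ⟨d, j⟩) ((bd dom cod d).shade j)
  intv_after : ∀ d j, intv ⟨d, j.succ⟩ = side (endpt ⟨d, j⟩) ((bd dom cod d).shade (j + 1))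
  /-- the surface is connected: every region is reached from every other by crossing strings -/
  connected : ∀ R R', Relation.EqvGen (fun a b => ∃ s, a = side s false ∧ b = side s true) R R'
  /-- the surface has Euler characteristic `2`: each disc contributes `1`, each string with end
  points `-1`, each closed loop `0`, and each region `2` minus the number of its boundary
  circles -/
  euler : Nat.card (Option ι) + 2 * Nat.card Reg =
    2 + Nat.card (Set.range endpt) + Nat.card (Circ endpt)

namespace Tangle

/-- `T'` is isotopic to `T` after renaming the input discs along `e`. -/
def IsIso {ι ι' : Type} {dom : ι → BoxType} {cod : BoxType} (e : ι' ≃ ι)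
    (T : Tangle dom cod) (T' : Tangle (fun i => dom (e i)) cod) : Prop :=
  ∃ (f : T.Str ≃ T'.Str) (g : T.Reg ≃ T'.Reg),
    (∀ j, T'.endpt ⟨none, j⟩ = f (T.endpt ⟨none, j⟩)) ∧
    (∀ i j, T'.endpt ⟨some i, j⟩ = f (T.endpt ⟨some (e i), j⟩)) ∧
    (∀ j, T'.intv ⟨none, j⟩ = g (T.intv ⟨none, j⟩)) ∧
    (∀ i j, T'.intv ⟨some i, j⟩ = g (T.intv ⟨some (e i), j⟩)) ∧
    (∀ s b, T'.side (f s) b = g (T.side s b))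

/-- `T'` is the mirror image of `T`: a reflection that preserves the distinguished intervals. -/
def IsReflection {ι : Type} {dom : ι → BoxType} {cod : BoxType} (T T' : Tangle dom cod) : Prop :=
  ∃ (f : T.Str ≃ T'.Str) (g : T.Reg ≃ T'.Reg),
    (∀ d j, T'.endpt ⟨d, j⟩ = f (T.endpt ⟨d, j.rev⟩)) ∧
    (∀ d j, T'.intv ⟨d, j⟩ = g (T.intv ⟨d, j.rev⟩)) ∧
    (∀ s b, T'.side (f s) b = g (T.side s b))

/-- Two closed tangles (no output boundary points) are isotopic on the sphere: they agree after the
output disc is forgotten. -/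
def IsSphericalIso {ι : Type} {dom : ι → BoxType} {ε ε' : Bool}
    (T : Tangle dom ⟨0, ε⟩) (T' : Tangle dom ⟨0, ε'⟩) : Prop :=
  ∃ (f : T.Str ≃ T'.Str) (g : T.Reg ≃ T'.Reg),
    (∀ i j, T'.endpt ⟨some i, j⟩ = f (T.endpt ⟨some i, j⟩)) ∧
    (∀ i j, T'.intv ⟨some i, j⟩ = g (T.intv ⟨some i, j⟩)) ∧
    (∀ s b, T'.side (f s) b = g (T.side s b))

/-- The identity tangle: every point and every interval of the input disc is joined radially to the
same point and interval of the output disc, and there are no closed loops. -/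
def IsIdentity {c : BoxType} (T : Tangle (fun _ : Unit => c) c) : Prop :=
  (∀ j : Fin (2 * c.n), T.endpt ⟨some (), j⟩ = T.endpt ⟨none, j⟩) ∧
  (∀ j : Fin (2 * c.n + 1), T.intv ⟨some (), j⟩ = T.intv ⟨none, j⟩) ∧
  (∀ s, s ∈ Set.range T.endpt)

/-- `U` is the result of gluing the tangle `S` into the input disc `none` of `T`.  The strings
(regions) of `U` are the classes of strings (regions) of `T` and `S` for the equivalence relation
generated by meeting at a common point (interval) of the disc along which they are glued. -/
def IsGluing {κ μ : Type} {dom : Option κ → BoxType} {dom' : μ → BoxType} {cod : BoxType}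
    (T : Tangle dom cod) (S : Tangle dom' (dom none))
    (U : Tangle (Sum.elim (fun k => dom (some k)) dom') cod) : Prop :=
  ∃ (f : T.Str ⊕ S.Str → U.Str) (g : T.Reg ⊕ S.Reg → U.Reg),
    Function.Surjective f ∧ Function.Surjective g ∧
    (∀ x y, f x = f y ↔ Relation.EqvGen (fun a b => ∃ j : Fin (2 * (dom none).n),
      a = .inl (T.endpt ⟨some none, j⟩) ∧ b = .inr (S.endpt ⟨none, j⟩)) x y) ∧
    (∀ x y, g x = g y ↔ Relation.EqvGen (fun a b => ∃ j : Fin (2 * (dom none).n + 1),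
      a = .inl (T.intv ⟨some none, j⟩) ∧ b = .inr (S.intv ⟨none, j⟩)) x y) ∧
    (∀ j, U.endpt ⟨none, j⟩ = f (.inl (T.endpt ⟨none, j⟩))) ∧
    (∀ k j, U.endpt ⟨some (.inl k), j⟩ = f (.inl (T.endpt ⟨some (some k), j⟩))) ∧
    (∀ m j, U.endpt ⟨some (.inr m), j⟩ = f (.inr (S.endpt ⟨some m, j⟩))) ∧
    (∀ j, U.intv ⟨none, j⟩ = g (.inl (T.intv ⟨none, j⟩))) ∧
    (∀ k j, U.intv ⟨some (.inl k), j⟩ = g (.inl (T.intv ⟨some (some k), j⟩))) ∧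
    (∀ m j, U.intv ⟨some (.inr m), j⟩ = g (.inr (S.intv ⟨some m, j⟩))) ∧
    (∀ s b, U.side (f (.inl s)) b = g (.inl (T.side s b))) ∧
    (∀ s b, U.side (f (.inr s)) b = g (.inr (S.side s b)))

end Tangle

namespace PlanarTangle

/-- A way to count the boundary circles. -/
theorem card_quot_eq {α C : Type} (r : α → α → Prop) (φ : α → C) (σ : C → α)
    (h : ∀ a b, r a b → φ a = φ b) (h₁ : ∀ c, φ (σ c) = c)
    (h₂ : ∀ a, Quot.mk r (σ (φ a)) = Quot.mk r a) : Nat.card (Quot r) = Nat.card C :=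
  Nat.card_congr
    { toFun := Quot.lift φ h
      invFun := fun c => Quot.mk r (σ c)
      left_inv := by rintro ⟨a⟩; exact h₂ a
      right_inv := h₁ }

section circ

variable {ι : Type} {dom : ι → BoxType} {cod : BoxType} {Str : Type} (e : Pt dom cod → Str)

theorem mk_before (d : Option ι) (j : ℕ) (h : j < 2 * (bd dom cod d).n) :
    Quot.mk (CircStep e) (.inl ⟨d, ⟨j, by omega⟩⟩) =
      Quot.mk _ (.inr (e ⟨d, ⟨j, h⟩⟩, (bd dom cod d).shade j)) :=
  Quot.sound (.before d ⟨j, h⟩)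

theorem mk_after (d : Option ι) (j : ℕ) (h : j < 2 * (bd dom cod d).n) :
    Quot.mk (CircStep e) (.inl ⟨d, ⟨j + 1, by omega⟩⟩) =
      Quot.mk _ (.inr (e ⟨d, ⟨j, h⟩⟩, (bd dom cod d).shade (j + 1))) :=
  Quot.sound (.after d ⟨j, h⟩)

theorem mk_adj (d : Option ι) (j : ℕ) (h : j + 1 < 2 * (bd dom cod d).n) :
    Quot.mk (CircStep e) (.inr (e ⟨d, ⟨j, by omega⟩⟩, (bd dom cod d).shade (j + 1))) =
      Quot.mk _ (.inr (e ⟨d, ⟨j + 1, h⟩⟩, (bd dom cod d).shade (j + 1))) :=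
  (mk_after e d j (by omega)).symm.trans (mk_before e d (j + 1) h)

theorem mk_wrap (d : Option ι) :
    Quot.mk (CircStep e) (.inl ⟨d, 0⟩) = Quot.mk _ (.inl ⟨d, Fin.last _⟩) :=
  Quot.sound (.wrap d)

theorem mk_adj_wrap (d : Option ι) (j : ℕ) (h : j + 1 = 2 * (bd dom cod d).n) :
    Quot.mk (CircStep e) (.inr (e ⟨d, ⟨0, by omega⟩⟩, (bd dom cod d).shade 0)) =
      Quot.mk _ (.inr (e ⟨d, ⟨j, by omega⟩⟩, (bd dom cod d).shade (j + 1))) := by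
  rw [← mk_before e d 0 (by omega), ← mk_after e d j (by omega)]
  have := mk_wrap e d
  have h2 : (Fin.last (2 * (bd dom cod d).n)) = ⟨j + 1, by omega⟩ := by ext; simp [h]
  rw [h2] at this
  exact this

/-- Counting boundary circles by a complete set `C` of representatives. -/
theorem card_circ {C : Type} (ψ : Itv dom cod → C) (χ : Str → Bool → C)
    (σ : C → Itv dom cod ⊕ (Str × Bool))
    (hw : ∀ d, ψ ⟨d, 0⟩ = ψ ⟨d, Fin.last _⟩)
    (hb : ∀ d j, ψ ⟨d, j.castSucc⟩ = χ (e ⟨d, j⟩) ((bd dom cod d).shade j))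
    (ha : ∀ d j, ψ ⟨d, j.succ⟩ = χ (e ⟨d, j⟩) ((bd dom cod d).shade (j + 1)))
    (h₁ : ∀ c, Sum.elim ψ (fun p => χ p.1 p.2) (σ c) = c)
    (hs : ∀ s b, Quot.mk (CircStep e) (σ (χ s b)) = Quot.mk _ (.inr (s, b)))
    (h₀ : ∀ d, (bd dom cod d).n = 0 →
      Quot.mk (CircStep e) (σ (ψ ⟨d, 0⟩)) = Quot.mk _ (.inl ⟨d, 0⟩)) :
    Nat.card (Circ e) = Nat.card C := by
  refine card_quot_eq _ (Sum.elim ψ (fun p => χ p.1 p.2)) σ ?_ h₁ ?_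
  · rintro _ _ (d | ⟨d, j⟩ | ⟨d, j⟩)
    exacts [hw d, hb d j, ha d j]
  · rintro (⟨d, j⟩ | ⟨s, b⟩)
    · refine Fin.lastCases ?_ (fun j => ?_) j
      · rw [← mk_wrap e d]
        change Quot.mk _ (σ (ψ _)) = _
        rw [← hw d]
        rcases Nat.eq_zero_or_pos (bd dom cod d).n with h | h
        · exact h₀ d h
        · have h2 := hb d ⟨0, by omega⟩
          have h3 := mk_before e d 0 (by omega)
          change ψ ⟨d, 0⟩ = _ at h2
          change Quot.mk _ (Sum.inl (Sigma.mk d 0)) = _ at h3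
          rw [h2, h3]
          exact hs _ _
      · change Quot.mk _ (σ (ψ _)) = _
        rw [hb d j, hs]
        exact (mk_before e d j j.isLt).symm
    · exact hs s b

end circ

/-- The empty tangle. -/
def emptyTangle (ε : Bool) : Tangle (fun i : Empty => i.elim) ⟨0, ε⟩ where
  Str := Empty
  Reg := Unit
  finite_str := inferInstance
  finite_reg := inferInstance
  endpt := fun p => match p with
    | ⟨none, j⟩ => Fin.elim0 j
  side s := s.elim
  intv _ := ()
  shade _ := ε
  shade_side s := s.elim
  shade_intv := by
    rintro (_ | i) j
    · have hj : j.val = 0 := Nat.lt_one_iff.mp j.isLt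
      simp [bd, BoxType.shade, hj]
    · exact i.elim
  endpt_inj := by rintro ⟨_ | i, j⟩; exacts [Fin.elim0 j, i.elim]
  endpt_pair := by rintro ⟨_ | i, j⟩; exacts [Fin.elim0 j, i.elim]
  intv_wrap _ := rfl
  intv_before := by rintro (_ | i) j; exacts [Fin.elim0 j, i.elim]
  intv_after := by rintro (_ | i) j; exacts [Fin.elim0 j, i.elim]
  connected _ _ := Relation.EqvGen.refl _
  euler := by
    rw [card_quot_eq (C := Unit) _ (fun _ => ()) (fun _ => .inl ⟨none, 0⟩) (fun _ _ _ => rfl)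
      (fun _ => rfl)]
    · simp
    · rintro (⟨_ | i, j⟩ | ⟨s, b⟩)
      · have hj : j = 0 := Fin.ext (Nat.lt_one_iff.mp j.isLt)
        rw [hj]
      · exact i.elim
      · exact s.elim

/-- The string ends of the coproduct tangle. -/
def coproductEnd : Pt (fun _ : Fin 2 => (⟨2, false⟩ : BoxType)) ⟨2, false⟩ → Fin 6
  | ⟨none, j⟩ => (![0, 1, 2, 3] : Fin 4 → Fin 6) j
  | ⟨some 0, j⟩ => (![0, 4, 5, 3] : Fin 4 → Fin 6) j
  | ⟨some 1, j⟩ => (![4, 1, 2, 5] : Fin 4 → Fin 6) j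

/-- The sides of the strings of the coproduct tangle. -/
def coproductSide (s : Fin 6) : Bool → Fin 5
  | false => (![0, 2, 2, 0, 4, 4] : Fin 6 → Fin 5) s
  | true => (![1, 1, 3, 3, 1, 3] : Fin 6 → Fin 5) s

/-- The regions at the intervals of the coproduct tangle. -/
def coproductItv : Itv (fun _ : Fin 2 => (⟨2, false⟩ : BoxType)) ⟨2, false⟩ → Fin 5
  | ⟨none, j⟩ => (![0, 1, 2, 3, 0] : Fin 5 → Fin 5) j
  | ⟨some 0, j⟩ => (![0, 1, 4, 3, 0] : Fin 5 → Fin 5) j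
  | ⟨some 1, j⟩ => (![4, 1, 2, 3, 4] : Fin 5 → Fin 5) j

/-- The coproduct tangle: the right hand boundary points of the left box (input disc `0`) are joined
to the left hand boundary points of the right box (input disc `1`).
The points of a `2`-box are: top left, top right, bottom right, bottom left.
The regions are: left, top (shaded), right, bottom (shaded), middle. -/
def coproductTangle : Tangle (fun _ : Fin 2 => (⟨2, false⟩ : BoxType)) ⟨2, false⟩ where
  Str := Fin 6
  Reg := Fin 5
  finite_str := inferInstance
  finite_reg := inferInstance
  endpt := coproductEnd
  side := coproductSide
  intv := coproductItv
  shade := ![false, true, false, true, false]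
  shade_side := by decide
  shade_intv := by decide
  endpt_inj := by
    rintro ⟨d, j⟩ ⟨d', j'⟩
    revert d d'
    decide
  endpt_pair := by decide
  intv_wrap := by decide
  intv_before := by decide
  intv_after := by decide
  connected := by
    have key : ∀ R : Fin 5, Relation.EqvGen (fun a b => ∃ s, a = coproductSide s false ∧
        b = coproductSide s true) R (1 : Fin 5) := by
      intro R
      have h (s : Fin 6) := Relation.EqvGen.rel (r := fun a b => ∃ s, a = coproductSide s false ∧
        b = coproductSide s true) _ _ ⟨s, rfl, rfl⟩
      fin_cases R
      exacts [h 0, .refl _, h 1, .trans _ _ _ (.symm _ _ (h 2)) (h 1), h 4]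
    exact fun R R' => .trans _ _ _ (key R) (.symm _ _ (key R'))
  euler := by
    have hr : Set.range coproductEnd = Set.univ :=
      Set.range_eq_univ.mpr (by decide +revert)
    rw [hr, card_circ (C := Fin 5) coproductEnd coproductItv coproductSide
      (fun R => .inr ((![0, 0, 1, 2, 4] : Fin 5 → Fin 6) R, ![false, true, false, true, false] R))
      (by decide) (by decide) (by decide) (by decide) ?_ ?_]
    · simp
    · have h (d) (j) (h) := mk_adj coproductEnd d j h
      have h' (d) (j) (h) := mk_adj_wrap coproductEnd d j h
      intro s b
      fin_cases s <;> cases b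
      · rfl
      · rfl
      · rfl
      · exact h none 0 (by decide)
      · exact h none 1 (by decide)
      · rfl
      · exact h' none 3 (by decide)
      · exact h none 2 (by decide)
      · rfl
      · exact h (some 0) 0 (by decide)
      · exact h (some 0) 1 (by decide)
      · exact h (some 1) 2 (by decide)
    · intro d hd
      exfalso
      revert d
      decide


/-- The column, counted from the left, of a boundary point: `0, …, n-1` on the top from left to right,
`n, …, 2n-1` on the bottom from right to left. -/
def col (n : ℕ) (j : Fin (2 * n)) : Fin n :=
  ⟨if (j : ℕ) < n then j else 2 * n - 1 - j, by have := j.isLt; split_ifs <;> omega⟩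

/-- The gap between columns at a boundary interval; gap `0` is on the left, gap `n` on the right. -/
def gap (n : ℕ) (j : Fin (2 * n + 1)) : Fin (n + 1) :=
  ⟨if (j : ℕ) ≤ n then j else 2 * n - j, by split_ifs <;> omega⟩

/-- The gap on the side with shading `b` of a string in column `i`. -/
def gapSide (c : BoxType) (i : Fin c.n) (b : Bool) : Fin (c.n + 1) :=
  if c.shade i = b then i.castSucc else i.succ

theorem shade_eq_iff (c : BoxType) (a b : ℕ) : c.shade a = c.shade b ↔ a % 2 = b % 2 := by
  unfold BoxType.shade
  have h1 := Nat.mod_two_eq_zero_or_one a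
  have h2 := Nat.mod_two_eq_zero_or_one b
  rcases h1 with h1 | h1 <;> rcases h2 with h2 | h2 <;> cases c.shaded <;> simp [h1, h2]

theorem shade_ne_iff (c : BoxType) (a : ℕ) (b : Bool) : c.shade a ≠ b ↔ c.shade (a + 1) = b := by
  unfold BoxType.shade
  rcases Nat.mod_two_eq_zero_or_one a with h1 | h1 <;> cases c.shaded <;> (cases b <;>
    simp [h1, Nat.add_mod])

theorem not_shade_eq_iff (c : BoxType) (a b : ℕ) :
    (!(c.shade a)) = c.shade b ↔ a % 2 ≠ b % 2 := by
  rw [Ne, ← shade_eq_iff c]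
  cases c.shade a <;> cases c.shade b <;> simp

theorem shade_gapSide (c : BoxType) (i : Fin c.n) (b : Bool) : c.shade (gapSide c i b) = b := by
  unfold gapSide
  split_ifs with h
  · exact h
  · exact (shade_ne_iff c i b).mp h

theorem shade_gap (c : BoxType) (j : Fin (2 * c.n + 1)) : c.shade (gap c.n j) = c.shade j := by
  rw [shade_eq_iff]
  have := j.isLt
  simp only [gap]
  split_ifs <;> omega

theorem gap_castSucc (c : BoxType) (j : Fin (2 * c.n)) :
    gap c.n j.castSucc = gapSide c (col c.n j) (c.shade j) := by
  have := j.isLt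
  simp only [gapSide, shade_eq_iff]
  ext
  simp only [gap, col, Fin.val_castSucc]
  split_ifs <;> simp <;> omega

theorem gap_succ (c : BoxType) (j : Fin (2 * c.n)) :
    gap c.n j.succ = gapSide c (col c.n j) (c.shade (j + 1)) := by
  have := j.isLt
  simp only [gapSide, shade_eq_iff]
  ext
  simp only [gap, col, Fin.val_succ]
  split_ifs <;> simp <;> omega

theorem gap_last (n : ℕ) : gap n 0 = gap n (Fin.last _) := by
  ext
  simp only [gap, Fin.val_last]
  split_ifs <;> simp at * <;> omega

theorem gap_zero (n : ℕ) : gap n 0 = 0 := by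
  ext; simp [gap]

theorem gapSide_cases (c : BoxType) (i : Fin c.n) :
    (gapSide c i false = i.castSucc ∧ gapSide c i true = i.succ) ∨
      (gapSide c i false = i.succ ∧ gapSide c i true = i.castSucc) := by
  unfold gapSide
  rcases Bool.eq_false_or_eq_true (c.shade i) with h | h <;> simp [h]

theorem eqv_gap {X : Type} (r : X → X → Prop) (c : BoxType) (F : Fin (c.n + 1) → X)
    (h : ∀ i, r (F (gapSide c i false)) (F (gapSide c i true))) (g : Fin (c.n + 1)) :
    Relation.EqvGen r (F g) (F 0) := by
  induction g using Fin.induction with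
  | zero => exact .refl _
  | succ i ih =>
    refine .trans _ _ _ ?_ ih
    have := h i
    rcases gapSide_cases c i with ⟨h1, h2⟩ | ⟨h1, h2⟩ <;> rw [h1, h2] at this
    · exact .symm _ _ (.rel _ _ this)
    · exact .rel _ _ this

theorem col_top (n : ℕ) (i : Fin n) : col n ⟨i, by omega⟩ = i := by
  ext; simp [col]

theorem col_bot (n : ℕ) (i : Fin n) : col n ⟨2 * n - 1 - i, by omega⟩ = i := by
  ext; simp only [col]; split_ifs <;> omega

section circ

variable {ι : Type} {dom : ι → BoxType} {cod : BoxType} {Str : Type} (e : Pt dom cod → Str)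

theorem mk_top (d : Option ι) (i : Fin (bd dom cod d).n) (b : Bool) :
    Quot.mk (CircStep e) (.inl ⟨d, ⟨gapSide (bd dom cod d) i b, by omega⟩⟩) =
      Quot.mk _ (.inr (e ⟨d, ⟨i, by omega⟩⟩, b)) := by
  by_cases h : (bd dom cod d).shade i = b
  · simp only [gapSide, if_pos h]
    have := mk_before e d i (by omega)
    rw [h] at this
    exact this
  · simp only [gapSide, if_neg h]
    have := mk_after e d i (by omega)
    rw [(shade_ne_iff _ _ _).mp h] at this
    exact this

theorem mk_bot (d : Option ι) (i : Fin (bd dom cod d).n) (b : Bool) :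
    Quot.mk (CircStep e)
        (.inl ⟨d, ⟨2 * (bd dom cod d).n - gapSide (bd dom cod d) i b, by omega⟩⟩) =
      Quot.mk _ (.inr (e ⟨d, ⟨2 * (bd dom cod d).n - 1 - i, by omega⟩⟩, b)) := by
  have hi := i.isLt
  by_cases h : (bd dom cod d).shade i = b
  · have := mk_after e d (2 * (bd dom cod d).n - 1 - i) (by omega)
    rw [show (bd dom cod d).shade (2 * (bd dom cod d).n - 1 - i + 1) = b by
      rw [← h, shade_eq_iff]; omega] at this
    rw [← this]
    congr 4
    simp only [gapSide, if_pos h, Fin.val_castSucc]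
    omega
  · have := mk_before e d (2 * (bd dom cod d).n - 1 - i) (by omega)
    rw [show (bd dom cod d).shade (2 * (bd dom cod d).n - 1 - i) = b by
      rw [← (shade_ne_iff _ _ _).mp h, shade_eq_iff]; omega] at this
    rw [← this]
    congr 4
    simp only [gapSide, if_neg h, Fin.val_succ]
    omega

end circ

/-- The string ends of the trace tangle. -/
def traceEnd (c : BoxType) : Pt (fun _ : Unit => c) ⟨0, c.shaded⟩ → Fin c.n
  | ⟨none, j⟩ => Fin.elim0 j
  | ⟨some (), j⟩ => col c.n j

theorem card_traceCirc (c : BoxType) : Nat.card (Circ (traceEnd c)) = c.n + 2 := by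
  rw [card_circ (C := Option (Fin (c.n + 1))) (traceEnd c)
    (fun p => match p with
      | ⟨none, _⟩ => none
      | ⟨some (), j⟩ => some (gap c.n j))
    (fun s b => some (gapSide c s b))
    (fun x => match x with
      | none => .inl ⟨none, 0⟩
      | some g => .inl ⟨some (), ⟨g, by change _ < 2 * c.n + 1; omega⟩⟩)]
  · simp
  · rintro (_ | _)
    exacts [rfl, congrArg some (gap_last c.n)]
  · rintro (_ | _) j
    exacts [Fin.elim0 j, congrArg some (gap_castSucc c j)]
  · rintro (_ | _) j
    exacts [Fin.elim0 j, congrArg some (gap_succ c j)]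
  · rintro (_ | g)
    · rfl
    · refine congrArg some ?_
      have := g.isLt
      ext
      simp only [gap]
      split_ifs <;> omega
  · intro s b
    have := mk_top (traceEnd c) (some ()) s b
    refine this.trans ?_
    congr 3
    exact col_top c.n s
  · rintro (_ | _) h
    · rfl
    · rfl

theorem range_traceEnd (c : BoxType) : Set.range (traceEnd c) = Set.univ :=
  Set.range_eq_univ.mpr fun i => ⟨⟨some (), ⟨i, by change _ < 2 * c.n; omega⟩⟩, col_top c.n i⟩

/-- The trace tangle: each top boundary point of the box is joined to the bottom boundary point below
it by a string that runs around the right of the box. -/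
def traceTangle (c : BoxType) : Tangle (fun _ : Unit => c) ⟨0, c.shaded⟩ where
  Str := Fin c.n
  Reg := Fin (c.n + 1)
  finite_str := inferInstance
  finite_reg := inferInstance
  endpt := traceEnd c
  side := gapSide c
  intv := fun p => match p with
    | ⟨none, _⟩ => 0
    | ⟨some (), j⟩ => gap c.n j
  shade g := c.shade g
  shade_side := shade_gapSide c
  shade_intv := by
    rintro (_ | i) j
    · have hj : j.val = 0 := Nat.lt_one_iff.mp j.isLt
      simp [bd, BoxType.shade, hj]
    · exact shade_gap c j
  endpt_inj := by
    rintro ⟨_ | _, j⟩ ⟨_ | _, j'⟩ h h'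
    · exact Fin.elim0 j
    · exact Fin.elim0 j
    · exact Fin.elim0 j'
    · change Fin (2 * c.n) at j j'
      change c.shade j = c.shade j' at h'
      rw [shade_eq_iff] at h'
      have hv : (col c.n j : ℕ) = col c.n j' := congrArg Fin.val h
      simp only [col] at hv
      have : j = j' := by
        ext
        have := j.isLt
        have := j'.isLt
        split_ifs at hv <;> omega
      rw [this]
  endpt_pair := by
    rintro ⟨_ | _, j⟩
    · exact Fin.elim0 j
    · change Fin (2 * c.n) at j
      refine ⟨⟨some (), j.rev⟩, ?_, ?_⟩
      · change col c.n j.rev = col c.n j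
        ext
        have := j.isLt
        simp only [col, Fin.val_rev]
        split_ifs <;> omega
      · change c.shade j.rev ≠ c.shade j
        rw [Ne, shade_eq_iff, Fin.val_rev]
        have := j.isLt
        omega
  intv_wrap := by
    rintro (_ | _)
    exacts [rfl, gap_last c.n]
  intv_before := by
    rintro (_ | _) j
    exacts [Fin.elim0 j, gap_castSucc c j]
  intv_after := by
    rintro (_ | _) j
    exacts [Fin.elim0 j, gap_succ c j]
  connected R R' :=
    have key := eqv_gap (fun a b => ∃ s, a = gapSide c s false ∧ b = gapSide c s true) c id
      (fun i => ⟨i, rfl, rfl⟩)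
    .trans _ _ _ (key R) (.symm _ _ (key R'))
  euler := by
    rw [card_traceCirc, range_traceEnd]
    simp
    omega

/-- In the multiplication tangle, the strings and the regions between them lie on three levels: above
the upper box (`0`), between the boxes (`1`), and below the lower box (`2`). -/
def mulLevel (c : BoxType) : (d : Option (Fin 2)) → ℕ → Fin 3
  | none, j => if j < c.n then 0 else 2
  | some 0, j => if j < c.n then 0 else 1
  | some 1, j => if j < c.n then 1 else 2

/-- The regions of the multiplication tangle; the regions on the far left and on the far right do not
depend on the level. -/
abbrev MulReg (n : ℕ) : Type :=
  {p : Fin 3 × Fin (n + 1) // ((p.2 : ℕ) = 0 ∨ (p.2 : ℕ) = n) → p.1 = 0}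

/-- The region at a given level and gap of the multiplication tangle. -/
def mulReg (n : ℕ) (l : Fin 3) (g : Fin (n + 1)) : MulReg n :=
  ⟨(if (g : ℕ) = 0 ∨ (g : ℕ) = n then 0 else l, g), fun h => if_pos h⟩

theorem mulReg_congr (n : ℕ) (l l' : Fin 3) (g : Fin (n + 1))
    (h : ¬((g : ℕ) = 0 ∨ (g : ℕ) = n) → l = l') : mulReg n l g = mulReg n l' g := by
  apply Subtype.ext
  simp only [mulReg]
  split_ifs with h'
  · rfl
  · rw [h h']

theorem card_mulReg (n : ℕ) (hn : n ≠ 0) : Nat.card (MulReg n) + 1 = 3 * n := by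
  obtain ⟨m, rfl⟩ := Nat.exists_eq_succ_of_ne_zero hn
  let f : (Fin 3 × Fin m) ⊕ Fin 2 → MulReg (m + 1) := fun x => match x with
    | .inl (l, k) => ⟨(l, ⟨k + 1, by omega⟩), fun h => by simp at h; omega⟩
    | .inr 0 => ⟨(0, 0), fun _ => rfl⟩
    | .inr 1 => ⟨(0, Fin.last _), fun _ => rfl⟩
  have hf : Function.Bijective f := by
    constructor
    · rintro (⟨l, k⟩ | i) (⟨l', k'⟩ | i') h
      · simp only [f, Subtype.mk.injEq, Prod.mk.injEq, Fin.mk.injEq] at h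
        have : k = k' := by ext; omega
        rw [h.1, this]
      · have h2 := congrArg (fun x : MulReg (m + 1) => (x.1.2 : ℕ)) h
        have := k.isLt
        fin_cases i' <;> simp [f] at h2 <;> omega
      · have h2 := congrArg (fun x : MulReg (m + 1) => (x.1.2 : ℕ)) h
        have := k'.isLt
        fin_cases i <;> simp [f] at h2 <;> omega
      · have h2 := congrArg (fun x : MulReg (m + 1) => (x.1.2 : ℕ)) h
        fin_cases i <;> fin_cases i' <;> simp [f] at h2 ⊢
    · rintro ⟨⟨l, g⟩, hg⟩
      have hlt := g.isLt
      by_cases h0 : (g : ℕ) = 0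
      · have hl : l = 0 := hg (.inl h0)
        refine ⟨.inr 0, Subtype.ext (Prod.ext hl.symm (Fin.ext h0.symm))⟩
      · by_cases h1 : (g : ℕ) = m + 1
        · have hl : l = 0 := hg (.inr h1)
          refine ⟨.inr 1, Subtype.ext (Prod.ext hl.symm (Fin.ext h1.symm))⟩
        · refine ⟨.inl (l, ⟨g - 1, by omega⟩), Subtype.ext (Prod.ext rfl (Fin.ext ?_))⟩
          change (g : ℕ) - 1 + 1 = g
          omega
  rw [← Nat.card_eq_of_bijective f hf]
  simp
  omega

/-- The string ends of the multiplication tangle. -/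
def mulEnd (c : BoxType) : Pt (fun _ : Fin 2 => c) c → Fin 3 × Fin c.n
  | ⟨none, j⟩ => (mulLevel c none j, col c.n j)
  | ⟨some i, j⟩ => (mulLevel c (some i) j, col c.n j)

/-- The regions at the intervals of the multiplication tangle. -/
def mulItv (c : BoxType) : Itv (fun _ : Fin 2 => c) c → MulReg c.n
  | ⟨none, j⟩ => mulReg c.n (mulLevel c none j) (gap c.n j)
  | ⟨some i, j⟩ => mulReg c.n (mulLevel c (some i) j) (gap c.n j)

/-- The sides of the strings of the multiplication tangle. -/
def mulSide (c : BoxType) (s : Fin 3 × Fin c.n) (b : Bool) : MulReg c.n :=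
  mulReg c.n s.1 (gapSide c s.2 b)

theorem mulLevel_succ (c : BoxType) (d : Option (Fin 2)) (j : Fin (2 * c.n))
    (h : (gap c.n j.succ : ℕ) ≠ c.n) : mulLevel c d (j + 1) = mulLevel c d j := by
  have : ((j : ℕ) + 1 < c.n) ↔ ((j : ℕ) < c.n) := by
    simp only [gap, Fin.val_succ] at h
    split_ifs at h <;> omega
  rcases d with _ | d
  · simp [mulLevel, this]
  · fin_cases d <;> simp [mulLevel, this]

theorem mulItv_wrap (c : BoxType) (d : Option (Fin 2)) :
    mulItv c ⟨d, 0⟩ = mulItv c ⟨d, Fin.last _⟩ := by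
  have h : ∀ l l', mulReg c.n l (gap c.n 0) = mulReg c.n l' (gap c.n (Fin.last _)) := by
    intro l l'
    rw [← gap_last]
    refine mulReg_congr _ _ _ _ fun h => absurd (Or.inl ?_) h
    rw [gap_zero]; rfl
  rcases d with _ | d
  exacts [h _ _, h _ _]

theorem mulItv_before (c : BoxType) (d : Option (Fin 2))
    (j : Fin (2 * (bd (fun _ : Fin 2 => c) c d).n)) :
    mulItv c ⟨d, j.castSucc⟩ =
      mulSide c (mulEnd c ⟨d, j⟩) ((bd (fun _ : Fin 2 => c) c d).shade j) := by
  rcases d with _ | d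
  all_goals
    change Fin (2 * c.n) at j
    change mulReg c.n _ (gap c.n j.castSucc) = mulReg c.n _ (gapSide c (col c.n j) (c.shade j))
    rw [gap_castSucc]
    rfl

theorem mulItv_after (c : BoxType) (d : Option (Fin 2))
    (j : Fin (2 * (bd (fun _ : Fin 2 => c) c d).n)) :
    mulItv c ⟨d, j.succ⟩ =
      mulSide c (mulEnd c ⟨d, j⟩) ((bd (fun _ : Fin 2 => c) c d).shade (j + 1)) := by
  have h : ∀ (d : Option (Fin 2)) (j : Fin (2 * c.n)),
      mulReg c.n (mulLevel c d (j + 1)) (gap c.n j.succ) =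
        mulReg c.n (mulLevel c d j) (gapSide c (col c.n j) (c.shade (j + 1))) := by
    intro d j
    rw [← gap_succ]
    exact mulReg_congr _ _ _ _ fun h => mulLevel_succ c d j fun h' => h (.inr h')
  rcases d with _ | d
  exacts [h none j, h (some d) j]

theorem mulEnd_top (c : BoxType) (d : Option (Fin 2)) (i : Fin c.n) :
    mulEnd c ⟨d, ⟨i, by rcases d with _ | d <;> (change _ < 2 * c.n; omega)⟩⟩ =
      ((match d with | none => 0 | some 0 => 0 | some 1 => 1), i) := by
  have hi := i.isLt
  rcases d with _ | d
  · exact Prod.ext (by simp [mulEnd, mulLevel]) (col_top c.n i)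
  · fin_cases d
    · exact Prod.ext (by simp [mulEnd, mulLevel]) (col_top c.n i)
    · exact Prod.ext (by simp [mulEnd, mulLevel]) (col_top c.n i)

theorem mulEnd_bot (c : BoxType) (d : Option (Fin 2)) (i : Fin c.n) :
    mulEnd c ⟨d, ⟨2 * c.n - 1 - i, by rcases d with _ | d <;> (change _ < 2 * c.n; omega)⟩⟩ =
      ((match d with | none => 2 | some 0 => 1 | some 1 => 2), i) := by
  have hi := i.isLt
  have hn : ¬(2 * c.n - 1 - (i : ℕ) < c.n) := by omega
  rcases d with _ | d
  · exact Prod.ext (by simp [mulEnd, mulLevel, hn]) (col_bot c.n i)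
  · fin_cases d
    · exact Prod.ext (by simp [mulEnd, mulLevel, hn]) (col_bot c.n i)
    · exact Prod.ext (by simp [mulEnd, mulLevel, hn]) (col_bot c.n i)

theorem range_mulEnd (c : BoxType) : Set.range (mulEnd c) = Set.univ := by
  refine Set.range_eq_univ.mpr ?_
  rintro ⟨l, i⟩
  fin_cases l
  · exact ⟨_, mulEnd_top c none i⟩
  · exact ⟨_, mulEnd_top c (some 1) i⟩
  · exact ⟨_, mulEnd_bot c none i⟩

theorem card_mulCirc_zero (c : BoxType) (hc : c.n = 0) : Nat.card (Circ (mulEnd c)) = 3 := by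
  have hem : ∀ s : Fin 3 × Fin c.n, False := fun s => by have := s.2.isLt; omega
  have hd : ∀ d, (bd (fun _ : Fin 2 => c) c d).n = 0 := by rintro (_ | d) <;> exact hc
  rw [card_circ (C := Option (Fin 2)) (mulEnd c) (fun p => p.1) (fun s _ => (hem s).elim)
    (fun d => .inl ⟨d, 0⟩) (fun _ => rfl)
    (fun d j => absurd j.isLt (by have := hd d; omega))
    (fun d j => absurd j.isLt (by have := hd d; omega))
    (fun _ => rfl) (fun s => (hem s).elim) (fun _ _ => rfl)]
  simp

theorem card_mulCirc (c : BoxType) (hc : c.n ≠ 0) :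
    Nat.card (Circ (mulEnd c)) = Nat.card (MulReg c.n) := by
  have hd : ∀ d, (bd (fun _ : Fin 2 => c) c d) = c := by rintro (_ | d) <;> rfl
  let it : Option (Fin 2) → (k : ℕ) → k < 2 * c.n + 1 → Itv (fun _ : Fin 2 => c) c :=
    fun d k h => ⟨d, ⟨k, by rw [hd]; exact h⟩⟩
  let mk := Quot.mk (CircStep (mulEnd c))
  have T0 : ∀ (i : Fin c.n) b, mk (.inl (it none (gapSide c i b) (by omega))) =
      mk (.inr ((0, i), b)) := fun i b =>
    (mk_top (mulEnd c) none i b).trans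
      (congrArg (fun x => mk (.inr (x, b))) (mulEnd_top c none i))
  have T1 : ∀ (i : Fin c.n) b, mk (.inl (it (some 1) (gapSide c i b) (by omega))) =
      mk (.inr ((1, i), b)) := fun i b =>
    (mk_top (mulEnd c) (some 1) i b).trans
      (congrArg (fun x => mk (.inr (x, b))) (mulEnd_top c (some 1) i))
  have B0 : ∀ (i : Fin c.n) b, mk (.inl (it none (2 * c.n - gapSide c i b) (by omega))) =
      mk (.inr ((2, i), b)) := fun i b =>
    (mk_bot (mulEnd c) none i b).trans
      (congrArg (fun x => mk (.inr (x, b))) (mulEnd_bot c none i))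
  have B1 : ∀ (i : Fin c.n) b, mk (.inl (it (some 1) (2 * c.n - gapSide c i b) (by omega))) =
      mk (.inr ((2, i), b)) := fun i b =>
    (mk_bot (mulEnd c) (some 1) i b).trans
      (congrArg (fun x => mk (.inr (x, b))) (mulEnd_bot c (some 1) i))
  have W : ∀ d k (h : k < 2 * c.n + 1), k = 0 ∨ k = c.n →
      mk (.inl (it d k h)) = mk (.inl (it d (2 * c.n - k) (by omega))) := by
    rintro d k h (rfl | rfl)
    · have := mk_wrap (mulEnd c) d
      refine (Eq.trans ?_ this).trans ?_
      · rfl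
      · change Quot.mk _ _ = Quot.mk _ _
        congr 4
        apply Fin.ext
        change 2 * (bd (fun _ : Fin 2 => c) c d).n = 2 * c.n - 0
        rw [hd]
        rfl
    · congr 4
      omega
  refine card_circ (mulEnd c) (mulItv c) (mulSide c)
    (fun R => .inl (match R.1.1 with
      | 0 => it none R.1.2 (by omega)
      | 1 => it (some 1) R.1.2 (by omega)
      | 2 => it none (2 * c.n - R.1.2) (by omega)))
    (mulItv_wrap c) (mulItv_before c) (mulItv_after c) ?_ ?_ ?_
  · rintro ⟨⟨l, g⟩, hg⟩
    have hlt := g.isLt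
    have hgap : gap c.n ⟨g, by omega⟩ = g := by
      ext; simp only [gap]; split_ifs <;> omega
    have hgap' : gap c.n ⟨2 * c.n - g, by omega⟩ = g := by
      ext; simp only [gap]; split_ifs <;> omega
    have key : ∀ l', (¬((g : ℕ) = 0 ∨ (g : ℕ) = c.n) → l' = l) →
        mulReg c.n l' g = ⟨(l, g), hg⟩ := by
      intro l' h
      refine (mulReg_congr _ _ _ _ h).trans (Subtype.ext (Prod.ext ?_ rfl))
      change (if _ then _ else _) = l
      split_ifs with h'
      exacts [(hg h').symm, rfl]
    fin_cases l
    · change mulReg c.n (mulLevel c none g) (gap c.n ⟨g, by omega⟩) = _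
      rw [hgap]
      exact key _ fun h => by rw [mulLevel, if_pos (by omega)]; rfl
    · change mulReg c.n (mulLevel c (some 1) g) (gap c.n ⟨g, by omega⟩) = _
      rw [hgap]
      exact key _ fun h => by rw [mulLevel, if_pos (by omega)]; rfl
    · change mulReg c.n (mulLevel c none (2 * c.n - g)) (gap c.n ⟨2 * c.n - g, by omega⟩) = _
      rw [hgap']
      exact key _ fun h => by rw [mulLevel, if_neg (by omega)]; rfl
  · rintro ⟨l, i⟩ b
    by_cases hg : (gapSide c i b : ℕ) = 0 ∨ (gapSide c i b : ℕ) = c.n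
    · have hl : (mulSide c (l, i) b) = ⟨(0, gapSide c i b), fun _ => rfl⟩ :=
        Subtype.ext (Prod.ext (if_pos hg) rfl)
      rw [hl]
      refine (T0 i b).trans ?_
      fin_cases l
      · rfl
      · exact (T0 i b).symm.trans <| (W none (gapSide c i b) (by omega) hg).trans <| (B0 i b).trans <|
          (B1 i b).symm.trans <| (W (some 1) (gapSide c i b) (by omega) hg).symm.trans <| T1 i b
      · exact (T0 i b).symm.trans <| (W none (gapSide c i b) (by omega) hg).trans <| B0 i b
    · have hl : (mulSide c (l, i) b) = ⟨(l, gapSide c i b), fun h => absurd h hg⟩ :=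
        Subtype.ext (Prod.ext (if_neg hg) rfl)
      rw [hl]
      fin_cases l
      exacts [T0 i b, T1 i b, B0 i b]
  · intro d h
    rw [hd] at h
    exact absurd h hc

/-- The multiplication tangle: the bottom boundary points of the upper box (input disc `0`) are
joined to the top boundary points of the lower box (input disc `1`). -/
def mulTangle (c : BoxType) : Tangle (fun _ : Fin 2 => c) c where
  Str := Fin 3 × Fin c.n
  Reg := MulReg c.n
  finite_str := inferInstance
  finite_reg := inferInstance
  endpt := mulEnd c
  side := mulSide c
  intv := mulItv c
  shade R := c.shade R.1.2
  shade_side s b := shade_gapSide c s.2 b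
  shade_intv := by
    rintro (_ | i) j
    exacts [shade_gap c j, shade_gap c j]
  endpt_inj := by
    rintro ⟨_ | i, j⟩ ⟨_ | i', j'⟩ h h'
    all_goals
      change Fin (2 * c.n) at j j'
      have := j.isLt
      have := j'.isLt
      have h1 := congrArg Prod.fst h
      have h2 := congrArg (fun x => (x.2 : ℕ)) h
      simp only [mulEnd, col] at h1 h2
    · change (!(c.shade j)) = (!(c.shade j')) at h'
      rw [Bool.not_inj_iff, shade_eq_iff] at h'
      have : j = j' := by ext; split_ifs at h2 <;> omega
      rw [this]
    · change (!(c.shade j)) = c.shade j' at h'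
      rw [not_shade_eq_iff] at h'
      exfalso
      fin_cases i' <;> simp only [mulLevel] at h1 <;> split_ifs at h1 h2 <;>
        omega
    · change c.shade j = (!(c.shade j')) at h'
      rw [eq_comm, not_shade_eq_iff] at h'
      exfalso
      fin_cases i <;> simp only [mulLevel] at h1 <;> split_ifs at h1 h2 <;>
        omega
    · change c.shade j = c.shade j' at h'
      rw [shade_eq_iff] at h'
      have hj : j = j' := by
        ext; split_ifs at h2 <;> omega
      have hi : i = i' := by
        subst hj
        fin_cases i <;> fin_cases i' <;>
          first | rfl | (simp only [mulLevel] at h1; split_ifs at h1 <;> simp at h1)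
      rw [hj, hi]
  endpt_pair := by
    have hcol : ∀ j : Fin (2 * c.n), col c.n j.rev = col c.n j := by
      intro j
      ext
      have := j.isLt
      simp only [col, Fin.val_rev]
      split_ifs <;> omega
    have hrev : ∀ j : Fin (2 * c.n), c.shade j.rev ≠ c.shade j := by
      intro j
      rw [Ne, shade_eq_iff, Fin.val_rev]
      have := j.isLt
      omega
    have h1 : ∀ (d d' : Option (Fin 2)) (j : Fin (2 * c.n)), mulLevel c d j = mulLevel c d' j →
        ((mulLevel c d j, col c.n j) : Fin 3 × Fin c.n) = (mulLevel c d' j, col c.n j) :=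
      fun _ _ _ h => by rw [h]
    have h2 : ∀ (d d' : Option (Fin 2)) (j : Fin (2 * c.n)),
        mulLevel c d j.rev = mulLevel c d' j →
        ((mulLevel c d j.rev, col c.n j.rev) : Fin 3 × Fin c.n) = (mulLevel c d' j, col c.n j) :=
      fun _ _ _ h => by rw [h, hcol]
    have hr : ∀ j : Fin (2 * c.n), ((j.rev : ℕ) < c.n ↔ ¬ (j : ℕ) < c.n) := by
      intro j
      have := j.isLt
      rw [Fin.val_rev]
      omega
    rintro ⟨_ | i, j⟩
    · change Fin (2 * c.n) at j
      by_cases hj : (j : ℕ) < c.n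
      · refine ⟨⟨some 0, j⟩, h1 (some 0) none j ?_, ?_⟩
        · simp [mulLevel, hj]
        · change c.shade j ≠ !(c.shade j)
          simp
      · refine ⟨⟨some 1, j⟩, h1 (some 1) none j ?_, ?_⟩
        · simp [mulLevel, hj]
        · change c.shade j ≠ !(c.shade j)
          simp
    · change Fin (2 * c.n) at j
      by_cases hj : (j : ℕ) < c.n <;> fin_cases i
      · refine ⟨⟨none, j⟩, h1 none (some 0) j ?_, ?_⟩
        · simp [mulLevel, hj]
        · change (!(c.shade j)) ≠ c.shade j
          simp
      · refine ⟨⟨some 0, j.rev⟩, h2 (some 0) (some 1) j ?_, hrev j⟩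
        simp only [mulLevel, hr, hj]
        simp
      · refine ⟨⟨some 1, j.rev⟩, h2 (some 1) (some 0) j ?_, hrev j⟩
        simp only [mulLevel, hr, hj]
        simp
      · refine ⟨⟨none, j⟩, h1 none (some 1) j ?_, ?_⟩
        · simp [mulLevel, hj]
        · change (!(c.shade j)) ≠ c.shade j
          simp
  intv_wrap := mulItv_wrap c
  intv_before := mulItv_before c
  intv_after := mulItv_after c
  connected R R' := by
    have key : ∀ R, Relation.EqvGen (fun a b => ∃ s, a = mulSide c s false ∧ b = mulSide c s true)
        R (mulReg c.n 0 0) := by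
      rintro ⟨⟨l, g⟩, hg⟩
      have h := eqv_gap (fun a b => ∃ s, a = mulSide c s false ∧ b = mulSide c s true) c
        (mulReg c.n l) (fun i => ⟨(l, i), rfl, rfl⟩) g
      have e1 : mulReg c.n l g = ⟨(l, g), hg⟩ := by
        refine Subtype.ext (Prod.ext ?_ rfl)
        change (if _ then _ else _) = l
        split_ifs with h'
        exacts [(hg h').symm, rfl]
      rw [e1, mulReg_congr c.n l 0 0 (fun h => absurd (Or.inl rfl) h)] at h
      exact h
    exact .trans _ _ _ (key R) (.symm _ _ (key R'))
  euler := by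
    rw [range_mulEnd]
    by_cases hc : c.n = 0
    · rw [card_mulCirc_zero c hc]
      have : Nat.card (MulReg c.n) = 1 := by
        rw [Nat.card_eq_one_iff_unique]
        refine ⟨⟨fun x y => ?_⟩, ⟨mulReg c.n 0 0⟩⟩
        have hx := x.1.2.isLt
        have hy := y.1.2.isLt
        refine Subtype.ext (Prod.ext ?_ (Fin.ext (by omega)))
        rw [x.2 (.inl (by omega)), y.2 (.inl (by omega))]
      rw [this]
      simp [hc]
    · rw [card_mulCirc c hc]
      have := card_mulReg c.n hc
      have e1 : Nat.card (Option (Fin 2)) = 3 := by simp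
      have e2 : Nat.card (Set.univ : Set (Fin 3 × Fin c.n)) = 3 * c.n := by simp
      rw [e1, e2]
      omega

end PlanarTangle

/-- A (unital, shaded) planar algebra over `ℂ`. -/
structure PlanarAlgebra where
  /-- the space of `c`-boxes -/
  V : BoxType → Type*
  [addCommGroup : ∀ c, AddCommGroup (V c)]
  [module : ∀ c, Module ℂ (V c)]
  /-- the multilinear map of a tangle -/
  Z : ∀ {ι : Type} [Finite ι] {dom : ι → BoxType} {cod : BoxType},
    Tangle dom cod → MultilinearMap ℂ (fun i => V (dom i)) (V cod)
  /-- isotopic tangles act in the same way, independently of the names of the input discs -/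
  Z_iso : ∀ {ι ι' : Type} [Finite ι] [Finite ι'] {dom : ι → BoxType} {cod : BoxType} (e : ι' ≃ ι)
    (T : Tangle dom cod) (T' : Tangle (fun i => dom (e i)) cod), T.IsIso e T' →
    ∀ x : ∀ i, V (dom i), Z T' (fun i => x (e i)) = Z T x
  /-- gluing of tangles is composition of multilinear maps -/
  Z_gluing : ∀ {κ μ : Type} [Finite κ] [Finite μ] {dom : Option κ → BoxType} {dom' : μ → BoxType}
    {cod : BoxType} (T : Tangle dom cod) (S : Tangle dom' (dom none))
    (U : Tangle (Sum.elim (fun k => dom (some k)) dom') cod), T.IsGluing S U →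
    ∀ (x : ∀ k, V (dom (some k))) (y : ∀ m, V (dom' m)),
      Z U (fun i => match i with
        | .inl k => x k
        | .inr m => y m) =
      Z T (fun i => match i with
        | none => Z S y
        | some k => x k)
  Z_identity : ∀ {c : BoxType} (T : Tangle (fun _ : Unit => c) c), T.IsIdentity →
    ∀ x : V c, Z T (fun _ => x) = x

attribute [instance] PlanarAlgebra.addCommGroup PlanarAlgebra.module

namespace PlanarAlgebra

variable (P : PlanarAlgebra)

/-- The empty diagram. -/
noncomputable def empty (ε : Bool) : P.V ⟨0, ε⟩ :=
  P.Z (PlanarTangle.emptyTangle ε) (fun i => i.elim)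

/-- The product of two boxes of the same type. -/
noncomputable def mul {c : BoxType} (a b : P.V c) : P.V c :=
  P.Z (PlanarTangle.mulTangle c) ![a, b]

/-- The (unnormalized) Markov trace, with values in the `0`-boxes. -/
noncomputable def trace {c : BoxType} (a : P.V c) : P.V ⟨0, c.shaded⟩ :=
  P.Z (PlanarTangle.traceTangle c) (fun _ => a)

/-- The coproduct of two `(2, +)`-boxes. -/
noncomputable def coproduct (a b : P.V ⟨2, false⟩) : P.V ⟨2, false⟩ :=
  P.Z PlanarTangle.coproductTangle ![a, b]

end PlanarAlgebra

/-- A planar `*`-algebra: conjugate linear involutions that are compatible with the reflection of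
tangles. -/
structure PlanarStarAlgebra extends PlanarAlgebra where
  star : ∀ {c : BoxType}, V c → V c
  star_star : ∀ {c : BoxType} (x : V c), star (star x) = x
  star_add : ∀ {c : BoxType} (x y : V c), star (x + y) = star x + star y
  star_smul : ∀ {c : BoxType} (a : ℂ) (x : V c), star (a • x) = (starRingEnd ℂ) a • star x
  star_Z : ∀ {ι : Type} [Finite ι] {dom : ι → BoxType} {cod : BoxType} (T T' : Tangle dom cod),
    T.IsReflection T' → ∀ x : ∀ i, V (dom i), star (Z T x) = Z T' (fun i => star (x i))

/-- A subfactor planar algebra: a spherical planar `*`-algebra with finite dimensional box spaces,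
whose `0`-box spaces are one dimensional (and identified with `ℂ` by sending the empty diagram
to `1`), and whose Markov trace induces positive definite inner products. -/
structure SubfactorPlanarAlgebra extends PlanarStarAlgebra where
  finite_dim : ∀ c, Module.Finite ℂ (V c)
  finrank_zero : ∀ ε, Module.finrank ℂ (V ⟨0, ε⟩) = 1
  empty_ne_zero : ∀ ε, toPlanarAlgebra.empty ε ≠ 0
  /-- the value of a closed diagram is invariant under isotopies of the sphere -/
  spherical : ∀ {ι : Type} [Finite ι] {dom : ι → BoxType} {ε ε' : Bool}
    (T : Tangle dom ⟨0, ε⟩) (T' : Tangle dom ⟨0, ε'⟩), T.IsSphericalIso T' →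
    ∀ (x : ∀ i, V (dom i)) (a : ℂ),
      Z T x = a • toPlanarAlgebra.empty ε → Z T' x = a • toPlanarAlgebra.empty ε'
  /-- `tr (x* x) > 0` for all nonzero boxes `x` -/
  trace_pos : ∀ {c : BoxType} (x : V c), x ≠ 0 → ∃ r : ℝ, 0 < r ∧
    toPlanarAlgebra.trace (toPlanarAlgebra.mul (star x) x) =
      (r : ℂ) • toPlanarAlgebra.empty c.shaded

namespace SubfactorPlanarAlgebra

variable (S : SubfactorPlanarAlgebra)

/-- A box is positive if it is a positive element of the finite dimensional C*-algebra of all boxes of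
its type. -/
def IsPositive {c : BoxType} (A : S.V c) : Prop :=
  ∃ a : S.V c, A = S.mul (S.star a) a

/-- A subfactor planar algebra is irreducible if its `1`-box spaces are one dimensional. -/
def IsIrreducible : Prop := ∀ ε, Module.finrank ℂ (S.V ⟨1, ε⟩) = 1

end SubfactorPlanarAlgebra

/-! Write `A = a* a`, `B = b* b`, and let `tr` be the Markov trace.

Positivity. For a `2`-box `y`, the closed diagram of `tr (y* (A * B) y)` can be cut along six
strings: the two between `a*` and `a`, the two between `b*` and `b`, and the two trace strings from
`y` to `y*`. The two pieces are mirror images of each other. Read as a `3`-box, the piece containing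
`a`, `b`, `y` is `h = half a b y`, so the diagram is `tr (h* h) ≥ 0` (`trace_mul_half`,
`star_half`). Hence left multiplication `L` by `C = A * B` is a positive operator on the finite
dimensional Hilbert space of `2`-boxes with inner product `tr (x* y)`. Choose a polynomial `p` with
`p(μ) μ = √μ` at each eigenvalue `μ` of `L`, and put `c = p(L) C`. Left multiplication by `c` is
`√L`, left multiplication by `c*` is its adjoint, so `c* c` and `C` act in the same way;
faithfulness of the trace gives `C = c* c` (`exists_eq_star_mul_self`).

Nonvanishing. `A` and `B` have nonzero trace, since the trace is faithful on positive elements.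
Joining the right points of `B` gives a `1`-box `cap B` of the same trace, hence nonzero, and
irreducibility makes the single string a multiple `γ • cap B`. The trace of `A * B` is a linear
functional of `cap B`, and the same functional sends the single string to `tr A`. Thus `tr A = γ tr
(A * B)`, so `A * B = 0` would force `tr A = 0` (`coproduct_ne_zero`).

Every diagrammatic identity is obtained by presenting one tangle as a gluing in two ways. Tangles
are given by finite tables, for which planarity, gluing, isotopy and reflection are decidable. -/

open PlanarTangle

/-! ### Bounded search in a generated equivalence relation. -/

namespace Tangle

section reach

variable {α J : Type}

/-- Whether `y` is reached from `x` by at most `k` of the moves `step j`. -/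
def reach [DecidableEq α] (step : J → α → α) (js : List J) : ℕ → α → α → Bool
  | 0, x, y => decide (x = y)
  | k + 1, x, y => decide (x = y) ||
      js.any fun j => !(decide (step j x = x)) && reach step js k (step j x) y

/-- A successful search is a chain of moves, each of which stays in its class. Only this soundness
is needed: a computation then certifies a statement about `EqvGen`. -/
theorem eqvGen_of_reach [DecidableEq α] {r : α → α → Prop} {step : J → α → α} {js : List J}
    (h : ∀ j x, Relation.EqvGen r x (step j x)) :
    ∀ {k : ℕ} {x y : α}, reach step js k x y = true → Relation.EqvGen r x y
  | 0, x, y, hr => by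
    obtain rfl : x = y := by simpa [reach] using hr
    exact .refl _
  | k + 1, x, y, hr => by
    simp only [reach, Bool.or_eq_true, decide_eq_true_eq, List.any_eq_true,
      Bool.and_eq_true] at hr
    rcases hr with rfl | ⟨j, _, _, hr⟩
    · exact .refl _
    · exact .trans _ _ _ (h j x) (eqvGen_of_reach h hr)

end reach

/-! ### Renaming the input discs of a tangle. -/

section reindex

variable {ι ι' : Type} {dom : ι → BoxType} {dom' : ι' → BoxType} {cod : BoxType}

theorem bd_map (e : ι' → ι) (hd : ∀ i, dom (e i) = dom' i) :
    ∀ d, bd dom cod (d.map e) = bd dom' cod d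
  | none => rfl
  | some i => hd i

/-- Renaming of the input discs on boundary points. -/
def mapPt (e : ι' → ι) (hd : ∀ i, dom (e i) = dom' i) (p : Pt dom' cod) : Pt dom cod :=
  ⟨p.1.map e, p.2.cast (by rw [bd_map e hd])⟩

/-- Renaming of the input discs on boundary intervals. -/
def mapItv (e : ι' → ι) (hd : ∀ i, dom (e i) = dom' i) (p : Itv dom' cod) : Itv dom cod :=
  ⟨p.1.map e, p.2.cast (by rw [bd_map e hd])⟩

theorem bijective_mapPt (e : ι' ≃ ι) (hd : ∀ i, dom (e i) = dom' i) :
    Function.Bijective (mapPt (cod := cod) e hd) := by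
  obtain rfl : dom' = fun i => dom (e i) := funext fun i => (hd i).symm
  constructor
  · rintro ⟨_ | i, j⟩ ⟨_ | i', j'⟩ h
    · simpa [mapPt] using h
    · simp [mapPt] at h
    · simp [mapPt] at h
    · simp only [mapPt, Option.map_some, Sigma.mk.injEq, Option.some.injEq,
        EmbeddingLike.apply_eq_iff_eq] at h
      obtain ⟨rfl, h⟩ := h
      have h := eq_of_heq h
      simpa using h
  · rintro ⟨_ | i, j⟩
    · exact ⟨⟨none, j⟩, rfl⟩
    · obtain ⟨i, rfl⟩ := e.surjective i
      exact ⟨⟨some i, j⟩, rfl⟩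

theorem bijective_mapItv (e : ι' ≃ ι) (hd : ∀ i, dom (e i) = dom' i) :
    Function.Bijective (mapItv (cod := cod) e hd) := by
  obtain rfl : dom' = fun i => dom (e i) := funext fun i => (hd i).symm
  constructor
  · rintro ⟨_ | i, j⟩ ⟨_ | i', j'⟩ h
    · simpa [mapItv] using h
    · simp [mapItv] at h
    · simp [mapItv] at h
    · simp only [mapItv, Option.map_some, Sigma.mk.injEq, Option.some.injEq,
        EmbeddingLike.apply_eq_iff_eq] at h
      obtain ⟨rfl, h⟩ := h
      have h := eq_of_heq h
      simpa using h
  · rintro ⟨_ | i, j⟩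
    · exact ⟨⟨none, j⟩, rfl⟩
    · obtain ⟨i, rfl⟩ := e.surjective i
      exact ⟨⟨some i, j⟩, rfl⟩

theorem isSource_mapPt (e : ι' → ι) (hd : ∀ i, dom (e i) = dom' i) (p : Pt dom' cod) :
    isSource dom cod (mapPt e hd p) = isSource dom' cod p := by
  obtain rfl : dom' = fun i => dom (e i) := funext fun i => (hd i).symm
  obtain ⟨_ | i, j⟩ := p <;> rfl

theorem circStep_map {Str : Type} (e : ι' ≃ ι) (hd : ∀ i, dom (e i) = dom' i)
    (en : Pt dom cod → Str) (a b : Itv dom' cod ⊕ (Str × Bool)) :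
    CircStep (fun p => en (mapPt e hd p)) a b ↔
      CircStep en (a.map (mapItv e hd) id) (b.map (mapItv e hd) id) := by
  obtain rfl : dom' = fun i => dom (e i) := funext fun i => (hd i).symm
  constructor
  · rintro (d | ⟨d, j⟩ | ⟨d, j⟩)
    · obtain _ | i := d
      exacts [.wrap none, .wrap (some (e i))]
    · obtain _ | i := d
      exacts [CircStep.before (endpt := en) none j, CircStep.before (endpt := en) (some (e i)) j]
    · obtain _ | i := d
      exacts [CircStep.after (endpt := en) none j, CircStep.after (endpt := en) (some (e i)) j]
  · intro h
    have key : ∀ x y, CircStep en x y → ∀ a b, x = a.map (mapItv e hd) id →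
        y = b.map (mapItv e hd) id → CircStep (fun p => en (mapPt e hd p)) a b := by
      have inj : Function.Injective
          (Sum.map (mapItv (cod := cod) e hd) (id : Str × Bool → Str × Bool)) :=
        Sum.map_injective.mpr ⟨(bijective_mapItv e hd).1, fun _ _ h => h⟩
      -- By injectivity of the renaming it is enough to exhibit one renamed preimage of each step.
      have red : ∀ x y a' b', x = Sum.map (mapItv e hd) id a' → y = Sum.map (mapItv e hd) id b' →
          CircStep (fun p => en (mapPt e hd p)) a' b' →
          ∀ a b, x = Sum.map (mapItv e hd) id a → y = Sum.map (mapItv e hd) id b →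
          CircStep (fun p => en (mapPt e hd p)) a b := by
        rintro x y a' b' rfl rfl h a b h1 h2
        rw [← inj h1, ← inj h2]
        exact h
      rintro _ _ (d | ⟨d, j⟩ | ⟨d, j⟩)
      · obtain _ | i := d
        · exact red _ _ _ _ rfl rfl (.wrap none)
        · obtain ⟨i, rfl⟩ := e.surjective i
          exact red _ _ _ _ rfl rfl (.wrap (some i))
      · obtain _ | i := d
        · exact red _ _ _ _ rfl rfl
            (CircStep.before (endpt := fun p => en (mapPt e hd p)) none j)
        · obtain ⟨i, rfl⟩ := e.surjective i
          exact red _ _ _ _ rfl rfl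
            (CircStep.before (endpt := fun p => en (mapPt e hd p)) (some i) j)
      · obtain _ | i := d
        · exact red _ _ _ _ rfl rfl
            (CircStep.after (endpt := fun p => en (mapPt e hd p)) none j)
        · obtain ⟨i, rfl⟩ := e.surjective i
          exact red _ _ _ _ rfl rfl
            (CircStep.after (endpt := fun p => en (mapPt e hd p)) (some i) j)
    exact key _ _ h a b rfl rfl

/-- Renaming of the input discs of a tangle. -/
def reindex (T : Tangle dom cod) (e : ι' ≃ ι) (hd : ∀ i, dom (e i) = dom' i) :
    Tangle dom' cod where
  Str := T.Str
  Reg := T.Reg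
  finite_str := T.finite_str
  finite_reg := T.finite_reg
  endpt p := T.endpt (mapPt e hd p)
  side := T.side
  intv p := T.intv (mapItv e hd p)
  shade := T.shade
  shade_side := T.shade_side
  shade_intv d j := by
    obtain rfl : dom' = fun i => dom (e i) := funext fun i => (hd i).symm
    obtain _ | i := d
    exacts [T.shade_intv none j, T.shade_intv (some (e i)) j]
  endpt_inj p q h h' := (bijective_mapPt e hd).1 <| T.endpt_inj _ _ h <| by
    rw [isSource_mapPt, isSource_mapPt, h']
  endpt_pair p := by
    obtain ⟨q, h, h'⟩ := T.endpt_pair (mapPt e hd p)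
    obtain ⟨q, rfl⟩ := (bijective_mapPt e hd).2 q
    rw [isSource_mapPt, isSource_mapPt] at h'
    exact ⟨q, h, h'⟩
  intv_wrap d := by
    obtain rfl : dom' = fun i => dom (e i) := funext fun i => (hd i).symm
    obtain _ | i := d
    exacts [T.intv_wrap none, T.intv_wrap (some (e i))]
  intv_before d j := by
    obtain rfl : dom' = fun i => dom (e i) := funext fun i => (hd i).symm
    obtain _ | i := d
    exacts [T.intv_before none j, T.intv_before (some (e i)) j]
  intv_after d j := by
    obtain rfl : dom' = fun i => dom (e i) := funext fun i => (hd i).symm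
    obtain _ | i := d
    exacts [T.intv_after none j, T.intv_after (some (e i)) j]
  connected := T.connected
  euler := by
    have h1 : Nat.card (Option ι') = Nat.card (Option ι) := Nat.card_congr (Equiv.optionCongr e)
    have h2 : Set.range (fun p => T.endpt (mapPt e hd p)) = Set.range T.endpt :=
      (bijective_mapPt e hd).2.range_comp T.endpt
    have h3 : Nat.card (Circ (fun p => T.endpt (mapPt e hd p))) = Nat.card (Circ T.endpt) :=
      Nat.card_congr <| Quot.congr
        (Equiv.sumCongr (Equiv.ofBijective _ (bijective_mapItv e hd)) (Equiv.refl _))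
        fun a b => circStep_map e hd T.endpt a b
    rw [h1, h2, h3]
    exact T.euler

end reindex

end Tangle

open Tangle

namespace PlanarAlgebra

variable (P : PlanarAlgebra) {ι ι' : Type} [Finite ι] [Finite ι'] {dom : ι → BoxType}
  {dom' : ι' → BoxType} {cod : BoxType}

/-- Renaming is an isotopy that is the identity on strings and regions. Box types agree only up to
the equations `hd`, hence the heterogeneous equality of inputs. -/
theorem Z_reindex (T : Tangle dom cod) (e : ι' ≃ ι) (hd : ∀ i, dom (e i) = dom' i)
    (x : ∀ i, P.V (dom i)) (x' : ∀ i, P.V (dom' i)) (hx : ∀ i, HEq (x' i) (x (e i))) :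
    P.Z (T.reindex e hd) x' = P.Z T x := by
  obtain rfl : dom' = fun i => dom (e i) := funext fun i => (hd i).symm
  obtain rfl : x' = fun i => x (e i) := funext fun i => eq_of_heq (hx i)
  exact P.Z_iso e T _ ⟨Equiv.refl _, Equiv.refl _, fun _ => rfl, fun _ _ => rfl, fun _ => rfl,
    fun _ _ => rfl, fun _ _ => rfl⟩ x

end PlanarAlgebra

/-! ### Tangles described by finite tables. -/

open PlanarTangle Tangle

/-- Combinatorial data for a tangle without closed loops, all of whose regions are bounded by
strings.  The first list in `ends` belongs to the output disc and the following ones to the input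
discs; `sides` lists the unshaded and the shaded side of each string.  Region `0` is the one that
touches the distinguished interval of the output disc if this disc has no boundary points. -/
structure TangleTable {k : ℕ} (dom : Fin k → BoxType) (cod : BoxType) where
  s : ℕ
  r : ℕ
  ends : List (List (Fin (s + 1)))
  sides : List (Fin (r + 1) × Fin (r + 1))

namespace TangleTable

variable {k : ℕ} {dom : Fin k → BoxType} {cod : BoxType} (τ : TangleTable dom cod)

/-- The string at a boundary point. -/
def row : Option (Fin k) → ℕ → Fin (τ.s + 1)
  | none, j => (τ.ends.getD 0 []).getD j 0
  | some i, j => (τ.ends.getD (i + 1) []).getD j 0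

/-- The region on a side of a string. -/
def side (s : Fin (τ.s + 1)) (b : Bool) : Fin (τ.r + 1) :=
  cond b (τ.sides.getD s (0, 0)).2 (τ.sides.getD s (0, 0)).1

/-- The region at a boundary interval. -/
def itv (d : Option (Fin k)) (j : ℕ) : Fin (τ.r + 1) :=
  if (bd dom cod d).n = 0 then 0
  else if j < 2 * (bd dom cod d).n then τ.side (τ.row d j) ((bd dom cod d).shade j)
  else τ.side (τ.row d (2 * (bd dom cod d).n - 1)) ((bd dom cod d).shade (2 * (bd dom cod d).n))

/-- Moving from a side of a string along a boundary interval to a side of the next string; the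
distinguished interval follows the last boundary point. -/
def corner (p : Option (Fin k) × ℕ) (x : Fin (τ.s + 1) × Bool) : Fin (τ.s + 1) × Bool :=
  let u := τ.row p.1 p.2
  let v := τ.row p.1 (if p.2 + 1 = 2 * (bd dom cod p.1).n then 0 else p.2 + 1)
  -- The corners of the output disc are traversed backwards. Each side of a string then has a single
  -- way to go on, so the search runs once around a boundary circle without branching.
  if p.2 < 2 * (bd dom cod p.1).n ∧
      x = (cond p.1.isNone v u, (bd dom cod p.1).shade (p.2 + 1)) then
    (cond p.1.isNone u v, x.2)
  else x

/-- The corners of all discs. -/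
def corners : List (Option (Fin k) × ℕ) :=
  (none :: (List.finRange k).map some).flatMap fun d =>
    (List.range (2 * (bd dom cod d).n)).map fun j => (d, j)

/-- Crossing a string. -/
def cross (s : Fin (τ.s + 1)) (R : Fin (τ.r + 1)) : Fin (τ.r + 1) :=
  if R = τ.side s false then τ.side s true
  else if R = τ.side s true then τ.side s false else R

/-- The conditions under which a table describes a planar tangle. -/
def Planar : Prop :=
  (∀ i, (dom i).n ≠ 0) ∧
  (∀ s t, τ.side s false ≠ τ.side t true) ∧
  (cod.n = 0 → cod.shaded = decide (∃ s, τ.side s true = 0)) ∧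
  (∀ d (j : Fin (2 * (bd dom cod d).n)) d' (j' : Fin (2 * (bd dom cod d').n)),
    τ.row d j = τ.row d' j' → isSource dom cod ⟨d, j⟩ = isSource dom cod ⟨d', j'⟩ →
    d = d' ∧ (j : ℕ) = j') ∧
  (∀ d (j : Fin (2 * (bd dom cod d).n)), ∃ d', ∃ j' : Fin (2 * (bd dom cod d').n),
    τ.row d' j' = τ.row d j ∧ isSource dom cod ⟨d', j'⟩ ≠ isSource dom cod ⟨d, j⟩) ∧
  (∀ s, ∃ d, ∃ j : Fin (2 * (bd dom cod d).n), τ.row d j = s) ∧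
  -- The region before a boundary point is right by definition of `itv`; only wrapping around and
  -- the region after a point have to be tested.
  (∀ d, τ.itv d 0 = τ.itv d (2 * (bd dom cod d).n)) ∧
  (∀ d (j : Fin (2 * (bd dom cod d).n)),
    τ.itv d (j + 1) = τ.side (τ.row d j) ((bd dom cod d).shade (j + 1))) ∧
  (∀ R, reach τ.cross (List.finRange _) (τ.r + 1) R 0 = true) ∧
  (∀ R, ∃ s, ∃ b, τ.side s b = R) ∧
  -- The string sides at one region form a single boundary circle.
  (∀ s t b, τ.side s b = τ.side t b →
    reach τ.corner (corners (dom := dom) (cod := cod)) (τ.s + 1) (s, b) (t, b) = true) ∧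
  -- Euler characteristic with one circle per region, and one more, free of strings, around an
  -- output disc without boundary points.
  k + 1 + 2 * (τ.r + 1) = 2 + (τ.s + 1) + ((τ.r + 1) + if cod.n = 0 then 1 else 0)

instance : Decidable τ.Planar := by unfold Planar; infer_instance

variable {τ}

theorem eqvGen_corner (p : Option (Fin k) × ℕ) (x : Fin (τ.s + 1) × Bool) :
    Relation.EqvGen (fun y z => Quot.mk (CircStep (dom := dom) (cod := cod)
      fun p => τ.row p.1 p.2) (.inr y) = Quot.mk _ (.inr z)) x (τ.corner p x) := by
  obtain ⟨d, j⟩ := p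
  have key : j < 2 * (bd dom cod d).n →
      Quot.mk (CircStep (dom := dom) (cod := cod) fun p => τ.row p.1 p.2)
        (.inr (τ.row d j, (bd dom cod d).shade (j + 1))) =
      Quot.mk _ (.inr (τ.row d (if j + 1 = 2 * (bd dom cod d).n then 0 else j + 1),
        (bd dom cod d).shade (j + 1))) := by
    intro h
    split_ifs with h'
    · have := mk_adj_wrap (dom := dom) (cod := cod) (fun p => τ.row p.1 p.2) d j h'
      rw [show (bd dom cod d).shade 0 = (bd dom cod d).shade (j + 1) by
        rw [shade_eq_iff]; omega] at this
      exact this.symm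
    · exact mk_adj (dom := dom) (cod := cod) (fun p => τ.row p.1 p.2) d j (by omega)
  unfold corner
  dsimp only
  by_cases hx : j < 2 * (bd dom cod d).n ∧ x = (cond d.isNone
      (τ.row d (if j + 1 = 2 * (bd dom cod d).n then 0 else j + 1)) (τ.row d j),
      (bd dom cod d).shade (j + 1))
  · rw [if_pos hx]
    obtain ⟨h, rfl⟩ := hx
    cases d.isNone
    exacts [.rel _ _ (key h), .rel _ _ (key h).symm]
  · rw [if_neg hx]
    exact .refl _

theorem eqvGen_cross (s : Fin (τ.s + 1)) (R : Fin (τ.r + 1)) :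
    Relation.EqvGen (fun a b => ∃ s, a = τ.side s false ∧ b = τ.side s true) R (τ.cross s R) := by
  unfold cross
  split_ifs with h h'
  · exact .rel _ _ ⟨s, h, rfl⟩
  · exact .symm _ _ (.rel _ _ ⟨s, rfl, h'⟩)
  · exact .refl _

theorem itv_before (d : Option (Fin k)) (j : Fin (2 * (bd dom cod d).n)) :
    τ.itv d j = τ.side (τ.row d j) ((bd dom cod d).shade j) := by
  have := j.isLt
  rw [itv, if_neg (by omega), if_pos this]

/-- One string side chosen at each region represents its boundary circle, because sides at the same
region are linked by corners. An output disc without boundary points adds the circle represented by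
its own interval. -/
theorem card_circ_row (h : τ.Planar) :
    Nat.card (Circ (dom := dom) (cod := cod) fun p => τ.row p.1 p.2) =
      (τ.r + 1) + if cod.n = 0 then 1 else 0 := by
  obtain ⟨hpos, hne, -, -, -, -, hwrap, hafter, -, hreg, hcirc, -⟩ := h
  have quot : ∀ s t b, τ.side s b = τ.side t b →
      Quot.mk (CircStep (dom := dom) (cod := cod) fun p => τ.row p.1 p.2) (.inr (s, b)) =
        Quot.mk _ (.inr (t, b)) := fun s t b hst =>
    -- Lying on the same circle is already an equivalence relation, so generating one from it adds
    -- nothing.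
    (Equivalence.eqvGen_iff (r := fun y z => Quot.mk (CircStep (dom := dom) (cod := cod)
      fun p => τ.row p.1 p.2) (.inr y) = Quot.mk _ (.inr z))
      ⟨fun _ => rfl, fun h => h.symm, fun h h' => h.trans h'⟩).mp
      (eqvGen_of_reach eqvGen_corner (hcirc s t b hst))
  choose σ β hσ using hreg
  have quot' : ∀ s b, Quot.mk (CircStep (dom := dom) (cod := cod) fun p => τ.row p.1 p.2)
      (.inr (σ (τ.side s b), β (τ.side s b))) = Quot.mk _ (.inr (s, b)) := by
    intro s b
    have h := hσ (τ.side s b)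
    -- No region is both the unshaded side of one string and the shaded side of another, so the
    -- chosen representative has the right colour.
    have hβ : β (τ.side s b) = b := by
      generalize β (τ.side s b) = b' at h
      cases b <;> cases b'
      exacts [rfl, absurd h.symm (hne _ _), absurd h (hne _ _), rfl]
    rw [hβ] at h ⊢
    exact quot _ _ _ h
  by_cases hcod : cod.n = 0
  · rw [card_circ (C := Option (Fin (τ.r + 1))) (fun p => τ.row p.1 p.2)
      (fun p => p.1.elim none fun i => some (τ.itv (some i) p.2))
      (fun s b => some (τ.side s b))
      (fun R => R.elim (.inl ⟨none, 0⟩) fun R => .inr (σ R, β R)), if_pos hcod]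
    · simp
    · rintro (_ | i)
      exacts [rfl, congrArg some (hwrap _)]
    · rintro (_ | i) j
      · have := j.isLt
        change _ < 2 * cod.n at this
        omega
      · exact congrArg some (itv_before _ _)
    · rintro (_ | i) j
      · have := j.isLt
        change _ < 2 * cod.n at this
        omega
      · exact congrArg some (hafter _ _)
    · rintro (_ | R)
      exacts [rfl, congrArg some (hσ R)]
    · exact quot'
    · rintro (_ | i) h0
      exacts [rfl, absurd h0 (hpos i)]
  · rw [card_circ (C := Fin (τ.r + 1)) (fun p => τ.row p.1 p.2)
      (fun p => τ.itv p.1 p.2) τ.side (fun R => .inr (σ R, β R)), if_neg hcod]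
    · simp
    · exact hwrap
    · exact itv_before
    · exact hafter
    · exact hσ
    · exact quot'
    · rintro (_ | i) h0
      exacts [absurd h0 hcod, absurd h0 (hpos i)]

theorem decide_side (h : τ.Planar) (s : Fin (τ.s + 1)) (b : Bool) :
    decide (∃ t, τ.side t true = τ.side s b) = b := by
  cases b
  · simpa using fun t ht => h.2.1 s t ht.symm
  · simp

/-- The tangle described by a table. -/
def tangle (τ : TangleTable dom cod) (h : τ.Planar) : Tangle dom cod where
  Str := Fin (τ.s + 1)
  Reg := Fin (τ.r + 1)
  finite_str := inferInstance
  finite_reg := inferInstance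
  endpt p := τ.row p.1 p.2
  side := τ.side
  intv p := τ.itv p.1 p.2
  -- The table does not store the shading; it is recovered from the strings around the region.
  shade R := decide (∃ s, τ.side s true = R)
  shade_side := decide_side h
  shade_intv d j := by
    have hj := j.isLt
    simp only [itv]
    split_ifs with h0 h1
    · obtain _ | i := d
      · change cod.n = 0 at h0
        have hj : (j : ℕ) = 0 := by change _ < 2 * cod.n + 1 at hj; omega
        rw [← h.2.2.1 h0, hj]
        simp [bd, BoxType.shade]
      · exact absurd h0 (h.1 i)
    · exact decide_side h _ _
    · rw [decide_side h, show (j : ℕ) = 2 * (bd dom cod d).n by omega]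
  endpt_inj := by
    rintro ⟨d, j⟩ ⟨d', j'⟩ h1 h2
    obtain ⟨rfl, h3⟩ := h.2.2.2.1 d j d' j' h1 h2
    rw [Fin.ext h3]
  endpt_pair p := by
    obtain ⟨d', j', h1, h2⟩ := h.2.2.2.2.1 p.1 p.2
    exact ⟨⟨d', j'⟩, h1, h2⟩
  intv_wrap := h.2.2.2.2.2.2.1
  intv_before := itv_before
  intv_after := h.2.2.2.2.2.2.2.1
  connected R R' :=
    have key R := eqvGen_of_reach eqvGen_cross (h.2.2.2.2.2.2.2.2.1 R)
    .trans _ _ _ (key R) (.symm _ _ (key R'))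
  euler := by
    rw [card_circ_row h, show Set.range (fun p : Pt dom cod => τ.row p.1 p.2) = Set.univ from
      Set.range_eq_univ.mpr fun s => by
        obtain ⟨d, j, hs⟩ := h.2.2.2.2.2.1 s
        exact ⟨⟨d, j⟩, hs⟩]
    simpa [add_assoc] using h.2.2.2.2.2.2.2.2.2.2.2

end TangleTable

/-! ### Gluing of tables. -/

namespace TangleTable

/-- One side of the gluing relation on strings or on regions. -/
def glueStep {α β J : Type} [DecidableEq α] [DecidableEq β] (p : J → α) (q : J → β) (j : J) :
    α ⊕ β → α ⊕ β
  | .inl a => if a = p j then .inr (q j) else .inl a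
  | .inr b => if b = q j then .inl (p j) else .inr b

theorem eqvGen_glueStep {α β J : Type} [DecidableEq α] [DecidableEq β] (p : J → α) (q : J → β)
    (j : J) (x : α ⊕ β) :
    Relation.EqvGen (fun a b => ∃ j, a = .inl (p j) ∧ b = .inr (q j)) x (glueStep p q j x) := by
  obtain a | b := x
  · dsimp only [glueStep]
    split_ifs with h
    · subst h; exact .rel _ _ ⟨j, rfl, rfl⟩
    · exact .refl _
  · dsimp only [glueStep]
    split_ifs with h
    · subst h; exact .symm _ _ (.rel _ _ ⟨j, rfl, rfl⟩)
    · exact .refl _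

/-- `f` must identify what the gluing identifies, which is tested on generators, and nothing more,
which the search certifies. -/
theorem eq_iff_eqvGen_glue {α β γ J : Type} [DecidableEq α] [DecidableEq β] {p : J → α}
    {q : J → β} {f : α ⊕ β → γ} {js : List J} {N : ℕ} (h : ∀ j, f (.inl (p j)) = f (.inr (q j)))
    (h' : ∀ x y, f x = f y → reach (glueStep p q) js N x y = true) (x y : α ⊕ β) :
    f x = f y ↔ Relation.EqvGen (fun a b => ∃ j, a = .inl (p j) ∧ b = .inr (q j)) x y := by
  refine ⟨fun hxy => eqvGen_of_reach (eqvGen_glueStep p q) (h' x y hxy), fun hxy => ?_⟩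
  induction hxy with
  | rel a b hab => obtain ⟨j, rfl, rfl⟩ := hab; exact h j
  | refl => rfl
  | symm _ _ _ ih => exact ih.symm
  | trans _ _ _ _ _ ih ih' => exact ih.trans ih'

variable {kT kS kU k : ℕ} {domT : Fin kT → BoxType} {domS : Fin kS → BoxType}
  {domU : Fin kU → BoxType} {cod codS : BoxType}

/-- `U` is the result of gluing `S` into the input disc `i₀` of `T`; the other input discs of `T` are
the `a k`, which become the input discs `b k` of `U`, and the input disc `m` of `S` becomes the input
disc `c m` of `U`; `f`, `f'` are the maps on strings and `g`, `g'` are the maps on regions. -/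
def Glues (T : TangleTable domT cod) (S : TangleTable domS codS) (U : TangleTable domU cod)
    (i₀ : Fin kT) (a : Fin k → Fin kT) (b : Fin k → Fin kU) (c : Fin kS → Fin kU)
    (f : Fin (T.s + 1) → Fin (U.s + 1)) (f' : Fin (S.s + 1) → Fin (U.s + 1))
    (g : Fin (T.r + 1) → Fin (U.r + 1)) (g' : Fin (S.r + 1) → Fin (U.r + 1)) : Prop :=
  Function.Bijective (fun o : Option (Fin k) => o.elim i₀ a) ∧
  Function.Bijective (Sum.elim b c) ∧
  codS = domT i₀ ∧ (∀ i, domT (a i) = domU (b i)) ∧ (∀ i, domS i = domU (c i)) ∧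
  Function.Surjective (Sum.elim f f') ∧ Function.Surjective (Sum.elim g g') ∧
  (∀ j : Fin (2 * codS.n), f (T.row (some i₀) j) = f' (S.row none j)) ∧
  (∀ j : Fin (2 * codS.n + 1), g (T.itv (some i₀) j) = g' (S.itv none j)) ∧
  (∀ x y, Sum.elim f f' x = Sum.elim f f' y →
    reach (glueStep (fun j : Fin (2 * codS.n) => T.row (some i₀) j) (fun j => S.row none j))
      (List.finRange _) (2 * codS.n) x y = true) ∧
  (∀ x y, Sum.elim g g' x = Sum.elim g g' y →
    reach (glueStep (fun j : Fin (2 * codS.n + 1) => T.itv (some i₀) j) (fun j => S.itv none j))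
      (List.finRange _) (2 * codS.n + 1) x y = true) ∧
  (∀ j : Fin (2 * cod.n), U.row none j = f (T.row none j)) ∧
  (∀ i, ∀ j : Fin (2 * (domT (a i)).n), U.row (some (b i)) j = f (T.row (some (a i)) j)) ∧
  (∀ i, ∀ j : Fin (2 * (domS i).n), U.row (some (c i)) j = f' (S.row (some i) j)) ∧
  (∀ j : Fin (2 * cod.n + 1), U.itv none j = g (T.itv none j)) ∧
  (∀ i, ∀ j : Fin (2 * (domT (a i)).n + 1), U.itv (some (b i)) j = g (T.itv (some (a i)) j)) ∧
  (∀ i, ∀ j : Fin (2 * (domS i).n + 1), U.itv (some (c i)) j = g' (S.itv (some i) j)) ∧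
  (∀ s b, U.side (f s) b = g (T.side s b)) ∧
  (∀ s b, U.side (f' s) b = g' (S.side s b))

instance (T : TangleTable domT cod) (S : TangleTable domS codS) (U : TangleTable domU cod)
    (i₀ : Fin kT) (a : Fin k → Fin kT) (b : Fin k → Fin kU) (c : Fin kS → Fin kU)
    (f : Fin (T.s + 1) → Fin (U.s + 1)) (f' : Fin (S.s + 1) → Fin (U.s + 1))
    (g : Fin (T.r + 1) → Fin (U.r + 1)) (g' : Fin (S.r + 1) → Fin (U.r + 1)) :
    Decidable (Glues T S U i₀ a b c f f' g g') := by
  unfold Glues Function.Surjective; infer_instance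

/-- The bridge from computation to planar algebra: a decidable check of three tables becomes an
identity of multilinear maps. `T` and `U` are renamed so that their input discs are indexed by the
`Option` and sum types which the gluing axiom expects. -/
theorem Z_glue (P : PlanarAlgebra) {T : TangleTable domT cod} {S : TangleTable domS codS}
    {U : TangleTable domU cod} (hT : T.Planar) (hS : S.Planar) (hU : U.Planar)
    {i₀ : Fin kT} {a : Fin k → Fin kT} {b : Fin k → Fin kU} {c : Fin kS → Fin kU}
    {f : Fin (T.s + 1) → Fin (U.s + 1)} {f' : Fin (S.s + 1) → Fin (U.s + 1)}
    {g : Fin (T.r + 1) → Fin (U.r + 1)} {g' : Fin (S.r + 1) → Fin (U.r + 1)}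
    (h : Glues T S U i₀ a b c f f' g g') (x : ∀ i, P.V (domT i)) (y : ∀ i, P.V (domS i))
    (z : ∀ i, P.V (domU i)) (hx : HEq (x i₀) (P.Z (S.tangle hS) y))
    (hz : ∀ i, HEq (z (b i)) (x (a i))) (hz' : ∀ i, HEq (z (c i)) (y i)) :
    P.Z (U.tangle hU) z = P.Z (T.tangle hT) x := by
  obtain ⟨hbT, hbU, rfl, hab, hc, hf, hg, hfr, hgr, hfe, hge, h1, h2, h3, h4, h5, h6, h7, h8⟩ := h
  let eT := Equiv.ofBijective _ hbT
  let eU := Equiv.ofBijective _ hbU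
  let T' : Tangle (fun o : Option (Fin k) => domT (eT o)) cod :=
    (T.tangle hT).reindex eT fun _ => rfl
  let U' : Tangle (Sum.elim (fun i : Fin k => domT (eT (some i))) domS) cod :=
    (U.tangle hU).reindex eU (by rintro (i | i); exacts [(hab i).symm, (hc i).symm])
  have hglue : T'.IsGluing (S.tangle hS) U' := by
    refine ⟨Sum.elim f f', Sum.elim g g', hf, hg,
      eq_iff_eqvGen_glue (α := Fin (T.s + 1)) (β := Fin (S.s + 1)) hfr hfe,
      eq_iff_eqvGen_glue (α := Fin (T.r + 1)) (β := Fin (S.r + 1)) hgr hge, h1, h2, h3, h4, h5, h6, h7, h8⟩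
  have := P.Z_gluing T' (S.tangle hS) U' hglue (fun i => x (a i)) y
  refine ((P.Z_reindex _ eU _ z _ ?_).symm.trans this).trans (P.Z_reindex _ eT _ x _ ?_)
  · rintro (i | i)
    exacts [(hz i).symm, (hz' i).symm]
  · rintro (_ | i)
    exacts [hx.symm, HEq.rfl]

end TangleTable

/-! ### Isotopies and reflections given on boundary points. -/

namespace PlanarAlgebra

variable (P : PlanarAlgebra) {ι ι' : Type} [Finite ι] [Finite ι'] {dom : ι → BoxType}
  {dom' : ι' → BoxType} {cod : BoxType}

/-- Isotopic tangles act in the same way, with an isotopy given by its effect on boundary points. -/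
theorem Z_eq_of_iso (T : Tangle dom cod) (U : Tangle dom' cod) (e : ι' → ι)
    (he : Function.Bijective e) (hd : ∀ i, dom (e i) = dom' i)
    (f : T.Str → U.Str) (hf : Function.Bijective f) (g : T.Reg → U.Reg)
    (hg : Function.Bijective g) (h1 : ∀ j, U.endpt ⟨none, j⟩ = f (T.endpt ⟨none, j⟩))
    (h2 : ∀ i j, U.endpt ⟨some i, j⟩ = f (T.endpt ⟨some (e i), Fin.cast (by simp [bd, hd]) j⟩))
    (h3 : ∀ j, U.intv ⟨none, j⟩ = g (T.intv ⟨none, j⟩))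
    (h4 : ∀ i j, U.intv ⟨some i, j⟩ = g (T.intv ⟨some (e i), Fin.cast (by simp [bd, hd]) j⟩))
    (h5 : ∀ s b, U.side (f s) b = g (T.side s b))
    (x : ∀ i, P.V (dom i)) (x' : ∀ i, P.V (dom' i)) (hx : ∀ i, HEq (x' i) (x (e i))) :
    P.Z U x' = P.Z T x := by
  obtain rfl : dom' = fun i => dom (e i) := funext fun i => (hd i).symm
  obtain rfl : x' = fun i => x (e i) := funext fun i => eq_of_heq (hx i)
  exact P.Z_iso (Equiv.ofBijective e he) T U
    ⟨Equiv.ofBijective f hf, Equiv.ofBijective g hg, h1, h2, h3, h4, h5⟩ x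

end PlanarAlgebra

/-- Mirror images act by the adjoint, with a reflection given by its effect on boundary points. -/
theorem PlanarStarAlgebra.star_Z_eq (P : PlanarStarAlgebra) {ι ι' : Type} [Finite ι] [Finite ι']
    {dom : ι → BoxType} {dom' : ι' → BoxType} {cod : BoxType}
    (T : Tangle dom cod) (U : Tangle dom' cod) (e : ι' → ι)
    (he : Function.Bijective e) (hd : ∀ i, dom (e i) = dom' i)
    (f : T.Str → U.Str) (hf : Function.Bijective f) (g : T.Reg → U.Reg)
    (hg : Function.Bijective g) (h1 : ∀ j, U.endpt ⟨none, j⟩ = f (T.endpt ⟨none, j.rev⟩))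
    (h2 : ∀ i j, U.endpt ⟨some i, j⟩ = f (T.endpt ⟨some (e i), Fin.cast (by simp [bd, hd]) j.rev⟩))
    (h3 : ∀ j, U.intv ⟨none, j⟩ = g (T.intv ⟨none, j.rev⟩))
    (h4 : ∀ i j, U.intv ⟨some i, j⟩ = g (T.intv ⟨some (e i), Fin.cast (by simp [bd, hd]) j.rev⟩))
    (h5 : ∀ s b, U.side (f s) b = g (T.side s b))
    (x : ∀ i, P.V (dom i)) (x' : ∀ i, P.V (dom' i)) (hx : ∀ i, HEq (x' i) (P.star (x (e i)))) :
    P.Z U x' = P.star (P.Z T x) := by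
  obtain rfl : dom' = fun i => dom (e i) := funext fun i => (hd i).symm
  obtain rfl : x' = fun i => P.star (x (e i)) := funext fun i => eq_of_heq (hx i)
  let e' := Equiv.ofBijective e he
  have hr : (T.reindex e' fun _ => rfl : Tangle (fun i => dom (e i)) cod).IsReflection U := by
    refine ⟨Equiv.ofBijective f hf, Equiv.ofBijective g hg, ?_, ?_, h5⟩
    · rintro (_ | i)
      exacts [h1, h2 i]
    · rintro (_ | i)
      exacts [h3, h4 i]
  rw [← P.star_Z _ U hr]
  exact congrArg P.star (P.Z_reindex T e' _ x _ fun _ => HEq.rfl)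

/-! ### The tables of the diagrams in the proof. -/

namespace TangleTable

/-- The box type with `2 * n` boundary points and unshaded distinguished interval. -/
abbrev box (n : ℕ) : BoxType := ⟨n, false⟩

/-- Multiplication of `2`-boxes. -/
def mul2Table : TangleTable (fun _ : Fin 2 => box 2) (box 2) where
  s := 5
  r := 4
  ends := [[0, 1, 5, 4], [0, 1, 3, 2], [2, 3, 5, 4]]
  sides := [(0, 1), (2, 1), (0, 3), (2, 3), (0, 4), (2, 4)]

theorem planar_mul2 : mul2Table.Planar := by decide +kernel

/-- Multiplication of `3`-boxes. -/
def mul3Table : TangleTable (fun _ : Fin 2 => box 3) (box 3) where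
  s := 8
  r := 7
  ends := [[0, 1, 2, 8, 7, 6], [0, 1, 2, 5, 4, 3], [3, 4, 5, 8, 7, 6]]
  sides := [(0, 1), (2, 1), (2, 3), (0, 4), (5, 4), (5, 3), (0, 6), (7, 6), (7, 3)]

theorem planar_mul3 : mul3Table.Planar := by decide +kernel

/-- The trace of `1`-boxes. -/
def trace1Table : TangleTable (fun _ : Fin 1 => box 1) (box 0) where
  s := 0
  r := 1
  ends := [[], [0, 0]]
  sides := [(0, 1)]

theorem planar_trace1 : trace1Table.Planar := by decide +kernel

/-- The trace of `2`-boxes. -/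
def trace2Table : TangleTable (fun _ : Fin 1 => box 2) (box 0) where
  s := 1
  r := 2
  ends := [[], [0, 1, 1, 0]]
  sides := [(0, 1), (2, 1)]

theorem planar_trace2 : trace2Table.Planar := by decide +kernel

/-- The trace of `3`-boxes. -/
def trace3Table : TangleTable (fun _ : Fin 1 => box 3) (box 0) where
  s := 2
  r := 3
  ends := [[], [0, 1, 2, 2, 1, 0]]
  sides := [(0, 1), (2, 1), (2, 3)]

theorem planar_trace3 : trace3Table.Planar := by decide +kernel

/-- The coproduct. -/
def coTable : TangleTable (fun _ : Fin 2 => box 2) (box 2) where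
  s := 5
  r := 4
  ends := [[0, 1, 2, 3], [0, 4, 5, 3], [4, 1, 2, 5]]
  sides := [(0, 1), (2, 1), (2, 3), (0, 3), (4, 1), (4, 3)]

theorem planar_co : coTable.Planar := by decide +kernel

/-- The product of three `2`-boxes. -/
def mul2ThreeTable : TangleTable (fun _ : Fin 3 => box 2) (box 2) where
  s := 7
  r := 5
  ends := [[0, 1, 5, 4], [0, 1, 7, 6], [6, 7, 3, 2], [2, 3, 5, 4]]
  sides := [(0, 1), (2, 1), (0, 3), (2, 3), (0, 4), (2, 4), (0, 5), (2, 5)]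

theorem planar_mul2Three : mul2ThreeTable.Planar := by decide +kernel

/-- The trace of a product of three boxes. -/
def traceMulThreeTable : TangleTable (fun _ : Fin 3 => box 2) (box 0) where
  s := 5
  r := 4
  ends := [[], [0, 1, 5, 4], [4, 5, 3, 2], [2, 3, 1, 0]]
  sides := [(0, 1), (2, 1), (0, 3), (2, 3), (0, 4), (2, 4)]

theorem planar_traceMulThree : traceMulThreeTable.Planar := by decide +kernel

/-- `tr (w (A * B) y)`. -/
def traceCoTable : TangleTable (fun _ : Fin 4 => box 2) (box 0) where
  s := 7
  r := 5
  ends := [[], [0, 1, 5, 4], [4, 6, 7, 2], [6, 5, 3, 7], [2, 3, 1, 0]]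
  sides := [(0, 1), (2, 1), (0, 3), (2, 3), (0, 4), (2, 4), (5, 4), (5, 3)]

theorem planar_traceCo : traceCoTable.Planar := by decide +kernel

/-- `tr (w (u a * B) y)`. -/
def traceCoMulLeftTable : TangleTable (fun _ : Fin 5 => box 2) (box 0) where
  s := 9
  r := 6
  ends := [[], [0, 1, 5, 4], [4, 6, 9, 8], [8, 9, 7, 2], [6, 5, 3, 7], [2, 3, 1, 0]]
  sides := [(0, 1), (2, 1), (0, 3), (2, 3), (0, 4), (2, 4), (5, 4), (5, 3), (0, 6), (5, 6)]

theorem planar_traceCoMulLeft : traceCoMulLeftTable.Planar := by decide +kernel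

/-- `tr (w (u a * v b) y)`. -/
def traceCoMulTable : TangleTable (fun _ : Fin 6 => box 2) (box 0) where
  s := 11
  r := 7
  ends := [[], [0, 1, 5, 4], [4, 6, 9, 8], [8, 9, 7, 2], [6, 5, 11, 10], [10, 11, 3, 7], [2, 3, 1, 0]]
  sides := [(0, 1), (2, 1), (0, 3), (2, 3), (0, 4), (2, 4), (5, 4), (5, 3), (0, 6), (5, 6), (5, 7), (2, 7)]

theorem planar_traceCoMul : traceCoMulTable.Planar := by decide +kernel

/-- The trace of a product of two `3`-boxes. -/
def traceMulTable : TangleTable (fun _ : Fin 2 => box 3) (box 0) where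
  s := 5
  r := 5
  ends := [[], [0, 1, 2, 5, 4, 3], [3, 4, 5, 2, 1, 0]]
  sides := [(0, 1), (2, 1), (2, 3), (0, 4), (5, 4), (5, 3)]

theorem planar_traceMul : traceMulTable.Planar := by decide +kernel

/-- The lower half of `a* a * b* b`, placed above `y`, as a `3`-box. -/
def halfTable : TangleTable (fun _ : Fin 3 => box 2) (box 3) where
  s := 8
  r := 6
  ends := [[0, 1, 2, 3, 4, 5], [0, 1, 6, 7], [2, 3, 8, 6], [7, 8, 4, 5]]
  sides := [(0, 1), (2, 1), (2, 3), (4, 3), (4, 5), (0, 5), (2, 6), (0, 6), (4, 6)]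

theorem planar_half : halfTable.Planar := by decide +kernel

/-- The mirror image of `half`. -/
def halfStarTable : TangleTable (fun _ : Fin 3 => box 2) (box 3) where
  s := 8
  r := 6
  ends := [[5, 4, 3, 2, 1, 0], [7, 6, 1, 0], [6, 8, 3, 2], [5, 4, 8, 7]]
  sides := [(0, 1), (2, 1), (2, 3), (4, 3), (4, 5), (0, 5), (2, 6), (0, 6), (4, 6)]

theorem planar_halfStar : halfStarTable.Planar := by decide +kernel

/-- The pairing of a `3`-box with `half`. -/
def traceMulHalfTable : TangleTable ![box 3, box 2, box 2, box 2] (box 0) where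
  s := 8
  r := 6
  ends := [[], [0, 1, 2, 5, 4, 3], [3, 4, 6, 7], [5, 2, 8, 6], [7, 8, 1, 0]]
  sides := [(0, 1), (2, 1), (2, 3), (0, 4), (5, 4), (5, 3), (5, 6), (0, 6), (2, 6)]

theorem planar_traceMulHalf : traceMulHalfTable.Planar := by decide +kernel

/-- Joining the right boundary points of a `2`-box. -/
def capTable : TangleTable (fun _ : Fin 1 => box 2) (box 1) where
  s := 2
  r := 2
  ends := [[0, 1], [0, 2, 2, 1]]
  sides := [(0, 1), (0, 1), (2, 1)]

theorem planar_cap : capTable.Planar := by decide +kernel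

/-- `tr (A * B)`, where the capped box `B` is an input. -/
def capPairingTable : TangleTable ![box 2, box 1] (box 0) where
  s := 2
  r := 2
  ends := [[], [0, 1, 2, 0], [1, 2]]
  sides := [(0, 1), (2, 1), (2, 1)]

theorem planar_capPairing : capPairingTable.Planar := by decide +kernel

/-- A single string. -/
def strandTable : TangleTable (fun i : Fin 0 => i.elim0) (box 1) where
  s := 0
  r := 1
  ends := [[0, 0]]
  sides := [(0, 1)]

theorem planar_strand : strandTable.Planar := by decide +kernel

/-- The trace of a coproduct. -/
def coTraceTable : TangleTable (fun _ : Fin 2 => box 2) (box 0) where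
  s := 3
  r := 3
  ends := [[], [0, 2, 3, 0], [2, 1, 1, 3]]
  sides := [(0, 1), (2, 1), (3, 1), (3, 1)]

theorem planar_coTrace : coTraceTable.Planar := by decide +kernel

/-! ### Gluing certificates. In the last four vectors, the entry at a position is the number which
that string or region of a piece gets in the glued tangle. -/

theorem glues_mulMulLeft : Glues mul2Table mul2Table mul2ThreeTable 0 ![1] ![2] ![0, 1]
    ![0, 1, 2, 3, 4, 5] ![0, 1, 6, 7, 2, 3]
    ![0, 1, 2, 3, 4] ![0, 1, 2, 5, 3] := by
  decide +kernel

theorem glues_mulMulRight : Glues mul2Table mul2Table mul2ThreeTable 1 ![0] ![0] ![1, 2]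
    ![0, 1, 6, 7, 4, 5] ![6, 7, 2, 3, 4, 5]
    ![0, 1, 2, 5, 4] ![0, 5, 2, 3, 4] := by
  decide +kernel

theorem glues_traceMulThree : Glues trace2Table mul2ThreeTable traceMulThreeTable 0 ![] ![] ![0, 1, 2]
    ![0, 1] ![0, 1, 2, 3, 0, 1, 4, 5]
    ![0, 1, 2] ![0, 1, 2, 3, 1, 4] := by
  decide +kernel

theorem glues_traceCo : Glues traceMulThreeTable coTable traceCoTable 1 ![0, 2] ![0, 3] ![1, 2]
    ![0, 1, 2, 3, 4, 5] ![4, 5, 3, 2, 6, 7]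
    ![0, 1, 2, 3, 4] ![0, 4, 2, 3, 5] := by
  decide +kernel

theorem glues_traceCoMulLeft : Glues traceCoTable mul2Table traceCoMulLeftTable 1 ![0, 2, 3] ![0, 3, 4] ![1, 2]
    ![0, 1, 2, 3, 4, 5, 6, 7] ![4, 6, 8, 9, 2, 7]
    ![0, 1, 2, 3, 4, 5] ![0, 4, 5, 6, 3] := by
  decide +kernel

theorem glues_traceCoMul : Glues traceCoMulLeftTable mul2Table traceCoMulTable 3 ![0, 1, 2, 4] ![0, 1, 2, 5] ![3, 4]
    ![0, 1, 2, 3, 4, 5, 6, 7, 8, 9] ![6, 5, 10, 11, 7, 3]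
    ![0, 1, 2, 3, 4, 5, 6] ![5, 4, 2, 7, 3] := by
  decide +kernel

theorem glues_traceMul : Glues trace3Table mul3Table traceMulTable 0 ![] ![] ![0, 1]
    ![0, 1, 2] ![0, 1, 2, 3, 4, 5, 0, 1, 2]
    ![0, 1, 2, 3] ![0, 1, 2, 3, 4, 5, 1, 2] := by
  decide +kernel

theorem glues_traceMulHalf : Glues traceMulTable halfTable traceMulHalfTable 1 ![0] ![0] ![1, 2, 3]
    ![0, 1, 2, 3, 4, 5] ![3, 4, 5, 2, 1, 0, 6, 7, 8]
    ![0, 1, 2, 3, 4, 5] ![0, 4, 5, 3, 2, 1, 6] := by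
  decide +kernel

/-- The crux of positivity: the two halves close up to the diagram of `tr (w (u a * v b) y)`. The
trace string on the right joins the lower right point of `v` to the upper right point of `b`. -/
theorem glues_traceHalfHalf : Glues traceMulHalfTable halfStarTable traceCoMulTable 0 ![1, 2, 3] ![2, 4, 5] ![1, 3, 0]
    ![0, 1, 11, 8, 9, 10, 7, 2, 3] ![8, 9, 10, 11, 1, 0, 6, 4, 5]
    ![0, 1, 2, 7, 6, 5, 3] ![0, 6, 5, 7, 2, 1, 4] := by
  decide +kernel

theorem glues_coTrace : Glues trace2Table coTable coTraceTable 0 ![] ![] ![0, 1]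
    ![0, 1] ![0, 1, 1, 0, 2, 3]
    ![0, 1, 2] ![0, 1, 2, 1, 3] := by
  decide +kernel

theorem glues_capPairingCap : Glues capPairingTable capTable coTraceTable 1 ![0] ![0] ![1]
    ![0, 2, 3] ![2, 3, 1]
    ![0, 1, 3] ![3, 1, 2] := by
  decide +kernel

theorem glues_capPairingStrand : Glues capPairingTable strandTable trace2Table 1 ![0] ![0] ![]
    ![0, 1, 1] ![1]
    ![0, 1, 2] ![2, 1] := by
  decide +kernel

theorem glues_traceCap : Glues trace1Table capTable trace2Table 0 ![] ![] ![0]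
    ![0] ![0, 0, 1]
    ![0, 1] ![0, 1, 2] := by
  decide +kernel

end TangleTable

/-! ### Comparison of tables with the defining tangles and with mirror images. -/

open PlanarTangle Tangle TangleTable

namespace TangleTable

instance (c : BoxType) : Fintype (mulTangle c).Str := inferInstanceAs (Fintype (Fin 3 × Fin c.n))
instance (c : BoxType) : DecidableEq (mulTangle c).Str :=
  inferInstanceAs (DecidableEq (Fin 3 × Fin c.n))
instance (c : BoxType) : Fintype (mulTangle c).Reg := inferInstanceAs (Fintype (MulReg c.n))
instance (c : BoxType) : DecidableEq (mulTangle c).Reg := inferInstanceAs (DecidableEq (MulReg c.n))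
instance (c : BoxType) : Fintype (traceTangle c).Str := inferInstanceAs (Fintype (Fin c.n))
instance (c : BoxType) : DecidableEq (traceTangle c).Str := inferInstanceAs (DecidableEq (Fin c.n))
instance (c : BoxType) : Fintype (traceTangle c).Reg := inferInstanceAs (Fintype (Fin (c.n + 1)))
instance (c : BoxType) : DecidableEq (traceTangle c).Reg :=
  inferInstanceAs (DecidableEq (Fin (c.n + 1)))
instance : Fintype coproductTangle.Str := inferInstanceAs (Fintype (Fin 6))
instance : DecidableEq coproductTangle.Str := inferInstanceAs (DecidableEq (Fin 6))
instance : Fintype coproductTangle.Reg := inferInstanceAs (Fintype (Fin 5))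
instance : DecidableEq coproductTangle.Reg := inferInstanceAs (DecidableEq (Fin 5))

variable {ι : Type} {k k' : ℕ} {dom : ι → BoxType} {domT : Fin k → BoxType}
  {domU : Fin k' → BoxType} {cod : BoxType}

/-- `U` is a table for the tangle `T`, after renaming the input discs along `e`. -/
def Describes (U : TangleTable domU cod) (T : Tangle dom cod) (e : Fin k' → ι)
    (hd : ∀ i, dom (e i) = domU i) (f : T.Str → Fin (U.s + 1)) (g : T.Reg → Fin (U.r + 1)) :
    Prop :=
  Function.Bijective f ∧ Function.Bijective g ∧
  (∀ j : Fin (2 * cod.n), U.row none j = f (T.endpt ⟨none, j⟩)) ∧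
  (∀ i, ∀ j : Fin (2 * (domU i).n),
    U.row (some i) j = f (T.endpt ⟨some (e i), Fin.cast (by simp [bd, hd]) j⟩)) ∧
  (∀ j : Fin (2 * cod.n + 1), U.itv none j = g (T.intv ⟨none, j⟩)) ∧
  (∀ i, ∀ j : Fin (2 * (domU i).n + 1),
    U.itv (some i) j = g (T.intv ⟨some (e i), Fin.cast (by simp [bd, hd]) j⟩)) ∧
  (∀ s b, U.side (f s) b = g (T.side s b))

instance (U : TangleTable domU cod) (T : Tangle dom cod) [Fintype T.Str] [DecidableEq T.Str]
    [Fintype T.Reg] [DecidableEq T.Reg] (e : Fin k' → ι)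
    (hd : ∀ i, dom (e i) = domU i) (f : T.Str → Fin (U.s + 1)) (g : T.Reg → Fin (U.r + 1)) :
    Decidable (U.Describes T e hd f g) := by
  unfold Describes Function.Bijective Function.Surjective; infer_instance

theorem Describes.Z_eq {P : PlanarAlgebra} [Finite ι] {U : TangleTable domU cod}
    {T : Tangle dom cod} {e : Fin k' → ι} {hd : ∀ i, dom (e i) = domU i}
    {f : T.Str → Fin (U.s + 1)} {g : T.Reg → Fin (U.r + 1)} (h : U.Describes T e hd f g)
    (hU : U.Planar) (he : Function.Bijective e) (x : ∀ i, P.V (dom i)) (x' : ∀ i, P.V (domU i))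
    (hx : ∀ i, HEq (x' i) (x (e i))) : P.Z (U.tangle hU) x' = P.Z T x := by
  obtain ⟨hf, hg, h1, h2, h3, h4, h5⟩ := h
  exact P.Z_eq_of_iso T (U.tangle hU) e he hd f hf g hg h1 h2 h3 h4 h5 x x' hx

/-- `U` is a table for the mirror image of the tangle with table `T`, after renaming the input discs
along `e`. -/
def Mirrors (U : TangleTable domU cod) (T : TangleTable domT cod) (e : Fin k' → Fin k)
    (f : Fin (T.s + 1) → Fin (U.s + 1)) (g : Fin (T.r + 1) → Fin (U.r + 1)) : Prop :=
  Function.Bijective f ∧ Function.Bijective g ∧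
  (∀ j : Fin (2 * cod.n), U.row none j = f (T.row none j.rev)) ∧
  (∀ i, ∀ j : Fin (2 * (domU i).n), U.row (some i) j = f (T.row (some (e i)) j.rev)) ∧
  (∀ j : Fin (2 * cod.n + 1), U.itv none j = g (T.itv none j.rev)) ∧
  (∀ i, ∀ j : Fin (2 * (domU i).n + 1), U.itv (some i) j = g (T.itv (some (e i)) j.rev)) ∧
  (∀ s b, U.side (f s) b = g (T.side s b))

instance (U : TangleTable domU cod) (T : TangleTable domT cod) (e : Fin k' → Fin k)
    (f : Fin (T.s + 1) → Fin (U.s + 1)) (g : Fin (T.r + 1) → Fin (U.r + 1)) :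
    Decidable (U.Mirrors T e f g) := by
  unfold Mirrors; infer_instance

theorem Mirrors.Z_eq {P : PlanarStarAlgebra} {U : TangleTable domU cod} {T : TangleTable domT cod}
    {e : Fin k' → Fin k} {f : Fin (T.s + 1) → Fin (U.s + 1)} {g : Fin (T.r + 1) → Fin (U.r + 1)}
    (h : U.Mirrors T e f g) (hT : T.Planar) (hU : U.Planar) (he : Function.Bijective e)
    (hd : ∀ i, domT (e i) = domU i) (x : ∀ i, P.V (domT i)) (x' : ∀ i, P.V (domU i))
    (hx : ∀ i, HEq (x' i) (P.star (x (e i)))) :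
    P.Z (U.tangle hU) x' = P.star (P.Z (T.tangle hT) x) := by
  obtain ⟨hf, hg, h1, h2, h3, h4, h5⟩ := h
  exact P.star_Z_eq (T.tangle hT) (U.tangle hU) e he hd f hf g hg h1 h2 h3 h4 h5 x x' hx

theorem describes_mul2 : mul2Table.Describes (mulTangle (box 2)) id (fun _ => rfl)
    (fun p => ![![0, 1], ![2, 3], ![4, 5]] p.1 p.2)
    (fun R => ![![0, 1, 2], ![0, 3, 2], ![0, 4, 2]] R.1.1 R.1.2) := by decide +kernel

theorem describes_mul3 : mul3Table.Describes (mulTangle (box 3)) id (fun _ => rfl)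
    (fun p => ![![0, 1, 2], ![3, 4, 5], ![6, 7, 8]] p.1 p.2)
    (fun R => ![![0, 1, 2, 3], ![0, 4, 5, 3], ![0, 6, 7, 3]] R.1.1 R.1.2) := by decide +kernel

theorem describes_trace1 : trace1Table.Describes (traceTangle (box 1)) (fun _ => ())
    (fun _ => rfl) (fun s => ![0] s) (fun R => ![0, 1] R) := by decide +kernel

theorem describes_trace2 : trace2Table.Describes (traceTangle (box 2)) (fun _ => ())
    (fun _ => rfl) (fun s => ![0, 1] s) (fun R => ![0, 1, 2] R) := by decide +kernel

theorem describes_trace3 : trace3Table.Describes (traceTangle (box 3)) (fun _ => ())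
    (fun _ => rfl) (fun s => ![0, 1, 2] s) (fun R => ![0, 1, 2, 3] R) := by decide +kernel

theorem describes_co : coTable.Describes coproductTangle id (fun _ => rfl)
    (fun s => ![0, 1, 2, 3, 4, 5] s) (fun R => ![0, 1, 2, 3, 4] R) := by
  decide +kernel

/-- Reflection exchanges the upper and the lower box; this makes the adjoint reverse products. -/
theorem mirrors_mul2 : mul2Table.Mirrors mul2Table ![1, 0] ![4, 5, 2, 3, 0, 1] ![0, 4, 2, 3, 1] := by
  decide +kernel

theorem mirrors_trace2 : trace2Table.Mirrors trace2Table id id id := by decide +kernel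

theorem mirrors_half : halfStarTable.Mirrors halfTable id ![0, 1, 2, 3, 4, 5, 6, 7, 8] ![0, 1, 2, 3, 4, 5, 6] := by decide +kernel

end TangleTable

/-! ### Diagrammatic identities. -/

namespace PlanarAlgebra

variable (P : PlanarAlgebra)

theorem Z_mul2 (a b : P.V (box 2)) : P.Z (mul2Table.tangle planar_mul2) ![a, b] = P.mul a b :=
  describes_mul2.Z_eq _ Function.bijective_id _ _ fun _ => HEq.rfl

theorem Z_mul3 (a b : P.V (box 3)) : P.Z (mul3Table.tangle planar_mul3) ![a, b] = P.mul a b :=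
  describes_mul3.Z_eq _ Function.bijective_id _ _ fun _ => HEq.rfl

theorem Z_trace1 (a : P.V (box 1)) :
    P.Z (trace1Table.tangle planar_trace1) (fun _ => a) = P.trace a :=
  describes_trace1.Z_eq _ (by decide) _ _ fun _ => HEq.rfl

theorem Z_trace2 (a : P.V (box 2)) :
    P.Z (trace2Table.tangle planar_trace2) (fun _ => a) = P.trace a :=
  describes_trace2.Z_eq _ (by decide) _ _ fun _ => HEq.rfl

theorem Z_trace3 (a : P.V (box 3)) :
    P.Z (trace3Table.tangle planar_trace3) (fun _ => a) = P.trace a :=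
  describes_trace3.Z_eq _ (by decide) _ _ fun _ => HEq.rfl

theorem Z_co (a b : P.V (box 2)) : P.Z (coTable.tangle planar_co) ![a, b] = P.coproduct a b :=
  describes_co.Z_eq _ Function.bijective_id _ _ fun _ => HEq.rfl

theorem mul_mul_left (a b c : P.V (box 2)) :
    P.Z (mul2ThreeTable.tangle planar_mul2Three) ![a, b, c] = P.mul (P.mul a b) c :=
  (Z_glue P planar_mul2 planar_mul2 planar_mul2Three glues_mulMulLeft ![P.mul a b, c] ![a, b] _
    (heq_of_eq (P.Z_mul2 a b).symm) (by intro i; fin_cases i <;> exact HEq.rfl)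
    (by intro i; fin_cases i <;> exact HEq.rfl)).trans (P.Z_mul2 _ _)

theorem mul_mul_right (a b c : P.V (box 2)) :
    P.Z (mul2ThreeTable.tangle planar_mul2Three) ![a, b, c] = P.mul a (P.mul b c) :=
  (Z_glue P planar_mul2 planar_mul2 planar_mul2Three glues_mulMulRight ![a, P.mul b c] ![b, c] _
    (heq_of_eq (P.Z_mul2 b c).symm) (by intro i; fin_cases i <;> exact HEq.rfl)
    (by intro i; fin_cases i <;> exact HEq.rfl)).trans (P.Z_mul2 _ _)

/-- Both sides are gluings that yield the same stack of three boxes. -/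
theorem mul_assoc (a b c : P.V (box 2)) : P.mul (P.mul a b) c = P.mul a (P.mul b c) :=
  (P.mul_mul_left a b c).symm.trans (P.mul_mul_right a b c)

theorem Z_traceMulThree (a b c : P.V (box 2)) :
    P.Z (traceMulThreeTable.tangle planar_traceMulThree) ![a, b, c] =
      P.trace (P.mul a (P.mul b c)) :=
  (Z_glue P planar_trace2 planar_mul2Three planar_traceMulThree glues_traceMulThree
    (fun _ => P.mul a (P.mul b c)) ![a, b, c] _ (heq_of_eq (P.mul_mul_right a b c).symm)
    (by intro i; fin_cases i) (by intro i; fin_cases i <;> exact HEq.rfl)).trans (P.Z_trace2 _)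

theorem Z_traceCo (w a b y : P.V (box 2)) :
    P.Z (traceCoTable.tangle planar_traceCo) ![w, a, b, y] =
      P.trace (P.mul w (P.mul (P.coproduct a b) y)) :=
  (Z_glue P planar_traceMulThree planar_co planar_traceCo glues_traceCo
    ![w, P.coproduct a b, y] ![a, b] _ (heq_of_eq (P.Z_co a b).symm)
    (by intro i; fin_cases i <;> exact HEq.rfl)
    (by intro i; fin_cases i <;> exact HEq.rfl)).trans (P.Z_traceMulThree _ _ _)

theorem Z_traceCoMul (w u a v b y : P.V (box 2)) :
    P.Z (traceCoMulTable.tangle planar_traceCoMul) ![w, u, a, v, b, y] =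
      P.trace (P.mul w (P.mul (P.coproduct (P.mul u a) (P.mul v b)) y)) :=
  ((Z_glue P planar_traceCoMulLeft planar_mul2 planar_traceCoMul glues_traceCoMul
    ![w, u, a, P.mul v b, y] ![v, b] _ (heq_of_eq (P.Z_mul2 v b).symm)
    (by intro i; fin_cases i <;> exact HEq.rfl)
    (by intro i; fin_cases i <;> exact HEq.rfl)).trans
  (Z_glue P planar_traceCo planar_mul2 planar_traceCoMulLeft glues_traceCoMulLeft
    ![w, P.mul u a, P.mul v b, y] ![u, a] _ (heq_of_eq (P.Z_mul2 u a).symm)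
    (by intro i; fin_cases i <;> exact HEq.rfl)
    (by intro i; fin_cases i <;> exact HEq.rfl))).trans (P.Z_traceCo _ _ _ _)

/-- The lower half of `a* a * b* b`, placed above `y`. -/
noncomputable def half (a b y : P.V (box 2)) : P.V (box 3) :=
  P.Z (halfTable.tangle planar_half) ![a, b, y]

/-- The mirror image of `half`. -/
noncomputable def halfStar (u v w : P.V (box 2)) : P.V (box 3) :=
  P.Z (halfStarTable.tangle planar_halfStar) ![u, v, w]

theorem Z_traceMul (a b : P.V (box 3)) :
    P.Z (traceMulTable.tangle planar_traceMul) ![a, b] = P.trace (P.mul a b) :=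
  (Z_glue P planar_trace3 planar_mul3 planar_traceMul glues_traceMul
    (fun _ => P.mul a b) ![a, b] _ (heq_of_eq (P.Z_mul3 a b).symm)
    (by intro i; fin_cases i) (by intro i; fin_cases i <;> exact HEq.rfl)).trans (P.Z_trace3 _)

/-- Both sides are the value of one closed tangle with six input discs. The case `u = a*`, `v = b*`,
`w = y*` turns the quadratic form of the coproduct into the squared norm of `half a b y`. -/
theorem trace_mul_half (w u a v b y : P.V (box 2)) :
    P.trace (P.mul (P.halfStar u v w) (P.half a b y)) =
      P.trace (P.mul w (P.mul (P.coproduct (P.mul u a) (P.mul v b)) y)) := by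
  rw [← Z_traceCoMul, ← Z_traceMul]
  symm
  let x : ∀ i, P.V ((![box 3, box 2, box 2, box 2] : Fin 4 → BoxType) i) := fun i =>
    match i with
    | 0 => P.halfStar u v w
    | 1 => a
    | 2 => b
    | 3 => y
  refine (Z_glue P planar_traceMulHalf planar_halfStar planar_traceCoMul glues_traceHalfHalf
    x ![u, v, w] _ HEq.rfl ?_ ?_).trans
    (Z_glue P planar_traceMul planar_half planar_traceMulHalf glues_traceMulHalf
    ![P.halfStar u v w, P.half a b y] ![a, b, y] _ HEq.rfl ?_ ?_)
  all_goals intro i; fin_cases i <;> exact HEq.rfl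

/-- Joining the right boundary points of a `2`-box. -/
noncomputable def cap (b : P.V (box 2)) : P.V (box 1) :=
  P.Z (capTable.tangle planar_cap) (fun _ => b)

/-- The trace closes the right column first and the left one afterwards. -/
theorem trace_cap (b : P.V (box 2)) : P.trace (P.cap b) = P.trace b := by
  rw [← Z_trace1, ← Z_trace2]
  symm
  refine Z_glue P planar_trace1 planar_cap planar_trace2 glues_traceCap
    (fun _ => P.cap b) (fun _ => b) _ HEq.rfl ?_ ?_
  all_goals intro i; fin_cases i <;> exact HEq.rfl

/-- The trace of a coproduct, as a function of the first box and of the second box after its right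
boundary points have been joined. -/
noncomputable def capPairing (a : P.V (box 2)) : P.V (box 1) →ₗ[ℂ] P.V ⟨0, false⟩ :=
  (P.Z (capPairingTable.tangle planar_capPairing)).toLinearMap (fun i =>
    match i with
    | 0 => a
    | 1 => (0 : P.V (box 1))) 1

theorem capPairing_cap (a b : P.V (box 2)) :
    P.capPairing a (P.cap b) = P.trace (P.coproduct a b) := by
  rw [← Z_trace2]
  refine (Z_glue P planar_capPairing planar_cap planar_coTrace glues_capPairingCap
    _ (fun _ => b) ![a, b] ?_ ?_ ?_).symm.trans
    (Z_glue P planar_trace2 planar_co planar_coTrace glues_coTrace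
    (fun _ => P.coproduct a b) ![a, b] _ (heq_of_eq (P.Z_co a b).symm) ?_ ?_)
  · simp; rfl
  all_goals intro i; fin_cases i <;> exact HEq.rfl

/-- A single string. -/
noncomputable def strand : P.V (box 1) :=
  P.Z (strandTable.tangle planar_strand) (fun i => i.elim0)

/-- A string put in place of the capped box joins the right points of `a` to each other, and its
left points are joined already. -/
theorem capPairing_strand (a : P.V (box 2)) : P.capPairing a P.strand = P.trace a := by
  rw [← Z_trace2]
  refine (Z_glue P planar_capPairing planar_strand planar_trace2 glues_capPairingStrand
    _ (fun i => i.elim0) (fun _ => a) ?_ ?_ ?_).symm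
  · simp; rfl
  all_goals intro i; fin_cases i <;> exact HEq.rfl

end PlanarAlgebra

/-! ### Adjoints of the diagrams. -/

namespace PlanarStarAlgebra

variable (P : PlanarStarAlgebra)

theorem star_mul (a b : P.V (box 2)) : P.star (P.mul a b) = P.mul (P.star b) (P.star a) := by
  rw [← PlanarAlgebra.Z_mul2, ← PlanarAlgebra.Z_mul2]
  refine (mirrors_mul2.Z_eq _ _ (by decide) (fun _ => rfl) _ _ ?_).symm
  intro i
  fin_cases i <;> exact HEq.rfl

theorem star_trace (a : P.V (box 2)) : P.star (P.trace a) = P.trace (P.star a) := by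
  rw [← PlanarAlgebra.Z_trace2, ← PlanarAlgebra.Z_trace2]
  exact (mirrors_trace2.Z_eq _ _ Function.bijective_id (fun _ => rfl) _ _ fun _ => HEq.rfl).symm

theorem star_half (a b y : P.V (box 2)) :
    P.star (P.half a b y) = P.halfStar (P.star a) (P.star b) (P.star y) := by
  refine (mirrors_half.Z_eq _ _ Function.bijective_id (fun _ => rfl) _ _ ?_).symm
  intro i
  fin_cases i <;> exact HEq.rfl

theorem star_empty : P.star (P.empty false) = P.empty false := by
  refine (P.star_Z_eq (emptyTangle false) (emptyTangle false)
    id Function.bijective_id (fun _ => rfl) id Function.bijective_id id Function.bijective_id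
    ?_ ?_ ?_ ?_ ?_ _ _ ?_).symm
  · exact fun j => Fin.elim0 j
  · exact fun i => i.elim
  · exact fun _ => rfl
  · exact fun _ _ => rfl
  · exact fun s => s.elim
  · exact fun i => i.elim

end PlanarStarAlgebra

/-! ### Square roots in a finite dimensional `*`-algebra. -/

/-- In a finite dimensional `*`-algebra with a faithful positive trace, an element that acts as a
positive operator is of the form `c* c`. -/
theorem exists_eq_star_mul_self {V : Type*} [AddCommGroup V] [Module ℂ V] [Module.Finite ℂ V]
    (m : V →ₗ[ℂ] V →ₗ[ℂ] V) (st : V → V) (τ : V →ₗ[ℂ] ℂ)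
    (st_st : ∀ x, st (st x) = x) (st_add : ∀ x y, st (x + y) = st x + st y)
    (st_smul : ∀ (a : ℂ) x, st (a • x) = (starRingEnd ℂ) a • st x)
    (assoc : ∀ x y z, m (m x y) z = m x (m y z)) (st_mul : ∀ x y, st (m x y) = m (st y) (st x))
    (τ_st : ∀ x, τ (st x) = (starRingEnd ℂ) (τ x))
    (pos : ∀ x, x ≠ 0 → ∃ r : ℝ, 0 < r ∧ τ (m (st x) x) = r)
    (C : V) (hC : ∀ y, ∃ r : ℝ, 0 ≤ r ∧ τ (m (st y) (m C y)) = r) : ∃ c, C = m (st c) c := by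
  have st_zero : st 0 = 0 := by simpa using st_smul 0 0
  let core : InnerProductSpace.Core ℂ V :=
    { inner := fun x y => τ (m (st x) y)
      conj_inner_symm := fun x y => by
        change (starRingEnd ℂ) (τ (m (st y) x)) = τ (m (st x) y)
        rw [← τ_st, st_mul, st_st]
      re_inner_nonneg := fun x => by
        by_cases hx : x = 0
        · simp [hx]
        · obtain ⟨r, hr, h⟩ := pos x hx
          rw [h]
          exact hr.le
      add_left := fun x y z => by
        change τ (m (st (x + y)) z) = τ (m (st x) z) + τ (m (st y) z)
        simp [st_add]
      smul_left := fun x y a => by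
        change τ (m (st (a • x)) y) = (starRingEnd ℂ) a * τ (m (st x) y)
        simp [st_smul]
      definite := fun x h => by
        change τ (m (st x) x) = 0 at h
        by_contra hx
        obtain ⟨r, hr, h'⟩ := pos x hx
        rw [h] at h'
        exact hr.ne (by exact_mod_cast h') }
  let _ : NormedAddCommGroup V := core.toNormedAddCommGroup
  let _ : InnerProductSpace ℂ V := InnerProductSpace.ofCore core.toCore
  have inner_def : ∀ x y : V, inner ℂ x y = τ (m (st x) y) := fun _ _ => rfl
  -- If `z = x - y` acts as zero then `z z* = 0`, and positivity of the trace at `z*` gives `z = 0`.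
  have faithful : ∀ x y : V, m x = m y → x = y := by
    intro x y h
    by_contra hne
    have hne' : st (x - y) ≠ 0 := fun h0 => hne <| sub_eq_zero.mp <| by
      rw [← st_st (x - y), h0, st_zero]
    obtain ⟨r, hr, h'⟩ := pos _ hne'
    rw [st_st, map_sub, h, sub_self] at h'
    simp only [LinearMap.zero_apply, map_zero] at h'
    exact hr.ne (by exact_mod_cast h')
  -- Over `ℂ`, symmetry follows from the quadratic form being real.
  have hpos : (m C).IsPositive := by
    rw [LinearMap.isPositive_iff_complex]
    intro x
    obtain ⟨r, hr, h⟩ := hC x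
    rw [← inner_conj_symm, inner_def, h]
    simpa using hr
  have hsym := hpos.isSymmetric
  let b := hsym.eigenvectorBasis rfl
  let μ := hsym.eigenvalues rfl
  have hμ : ∀ i, 0 ≤ μ i := hpos.nonneg_eigenvalues rfl
  have hb : ∀ i, m C (b i) = (μ i : ℂ) • b i := hsym.apply_eigenvectorBasis rfl
  -- Taking the image removes repeated eigenvalues. At the node `0` the value is `0 / 0 = 0`, which
  -- is harmless since `p(μ) μ = √μ` is all that is used.
  let p : Polynomial ℂ := Lagrange.interpolate (Finset.univ.image fun i => (μ i : ℂ)) id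
    fun z => ((Real.sqrt z.re / z.re : ℝ) : ℂ)
  have hp : ∀ i, p.eval (μ i : ℂ) = ((Real.sqrt (μ i) / μ i : ℝ) : ℂ) := fun i =>
    Lagrange.eval_interpolate_at_node (v := id) (s := Finset.univ.image fun i => (μ i : ℂ)) _
      (Set.injOn_id _) (Finset.mem_image_of_mem _ (Finset.mem_univ i))
  -- Applying the operator to `C` instead of a unit avoids needing a unit and supplies the extra
  -- factor `μ`.
  let c := Polynomial.aeval (m C) p C
  -- Associativity: left multiplication by `q(L) x` is `q(L)` after left multiplication by `x`.
  have comm : ∀ (q : Polynomial ℂ) (x y : V),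
      m (Polynomial.aeval (m C) q x) y = Polynomial.aeval (m C) q (m x y) := by
    intro q
    induction q using Polynomial.induction_on' with
    | add q q' h h' => intro x y; simp [h, h']
    | monomial n a =>
      intro x y
      simp only [Polynomial.aeval_monomial, Module.End.mul_apply, Module.algebraMap_end_apply,
        map_smul, LinearMap.smul_apply]
      congr 1
      induction n with
      | zero => rfl
      | succ n ih => rw [pow_succ', Module.End.mul_apply, Module.End.mul_apply, assoc, ih]
  have hc : ∀ i, m c (b i) = ((Real.sqrt (μ i) : ℝ) : ℂ) • b i := by
    intro i
    have hev : Module.End.HasEigenvector (m C) (μ i : ℂ) (b i) :=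
      hsym.hasEigenvector_eigenvectorBasis rfl i
    rw [comm, hb, map_smul, Module.End.aeval_apply_of_hasEigenvector hev, hp, smul_smul,
      ← Complex.ofReal_mul]
    congr 2
    by_cases h0 : μ i = 0
    · simp [h0]
    · field_simp
  -- Matrix entries in the eigenbasis: both `C` and `c* c` give `μ i` on the diagonal and `0`
  -- elsewhere.
  refine ⟨c, faithful _ _ (b.toBasis.ext fun i => InnerProductSpace.ext_inner_left_basis b.toBasis
    fun j => ?_)⟩
  have adj : inner ℂ (b j) (m (m (st c) c) (b i)) = inner ℂ (m c (b j)) (m c (b i)) := by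
    rw [inner_def, inner_def, assoc, st_mul, assoc]
  rw [b.coe_toBasis, adj, hb, hc, hc, inner_smul_left, inner_smul_right, inner_smul_right,
    orthonormal_iff_ite.mp b.orthonormal]
  split_ifs with h
  · subst h
    simp only [mul_one, Complex.conj_ofReal]
    rw [← Complex.ofReal_mul, Real.mul_self_sqrt (hμ j)]
  · simp

/-! ### Linearity of product and trace. -/

namespace PlanarAlgebra

variable (P : PlanarAlgebra)

/-- The product of `2`-boxes as a bilinear map. -/
noncomputable def mulLin : P.V (box 2) →ₗ[ℂ] P.V (box 2) →ₗ[ℂ] P.V (box 2) :=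
  have h0 (a b x : P.V (box 2)) : Function.update (β := fun _ : Fin 2 => P.V (box 2))
      ![a, b] 0 x = ![x, b] := by ext i; fin_cases i <;> rfl
  have h1 (a b x : P.V (box 2)) : Function.update (β := fun _ : Fin 2 => P.V (box 2))
      ![a, b] 1 x = ![a, x] := by ext i; fin_cases i <;> rfl
  LinearMap.mk₂ ℂ P.mul
    (fun a a' b => by
      have := (P.Z (mulTangle (box 2))).map_update_add ![a, b] 0 a a'
      rwa [h0, h0, h0] at this)
    (fun r a b => by
      have := (P.Z (mulTangle (box 2))).map_update_smul ![a, b] 0 r a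
      rwa [h0, h0] at this)
    (fun a b b' => by
      have := (P.Z (mulTangle (box 2))).map_update_add ![a, b] 1 b b'
      rwa [h1, h1, h1] at this)
    (fun r a b => by
      have := (P.Z (mulTangle (box 2))).map_update_smul ![a, b] 1 r b
      rwa [h1, h1] at this)

/-- The trace of `2`-boxes as a linear map. -/
noncomputable def traceLin : P.V (box 2) →ₗ[ℂ] P.V ⟨0, false⟩ :=
  have h (a x : P.V (box 2)) : Function.update (β := fun _ : Unit => P.V (box 2))
      (fun _ => a) () x = fun _ => x := by ext; rfl
  { toFun := P.trace
    map_add' a a' := by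
      have := (P.Z (traceTangle (box 2))).map_update_add (fun _ => a) () a a'
      rwa [h, h, h] at this
    map_smul' r a := by
      have := (P.Z (traceTangle (box 2))).map_update_smul (fun _ => a) () r a
      rwa [h, h] at this }

end PlanarAlgebra

/-! ### Positivity and nonvanishing of the coproduct. -/

namespace SubfactorPlanarAlgebra

variable (S : SubfactorPlanarAlgebra)

theorem exists_smul_empty (x : S.V ⟨0, false⟩) : ∃ r : ℂ, r • S.empty false = x :=
  (finrank_eq_one_iff_of_nonzero' _ (S.empty_ne_zero false)).mp (S.finrank_zero false) x

/-- The coefficient of the empty diagram in a `0`-box. -/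
noncomputable def coeff : S.V ⟨0, false⟩ →ₗ[ℂ] ℂ :=
  (LinearEquiv.ofBijective (LinearMap.toSpanSingleton ℂ (S.V ⟨0, false⟩) (S.empty false))
    ⟨fun _ _ h => smul_left_injective ℂ (S.empty_ne_zero false) h,
      S.exists_smul_empty⟩).symm.toLinearMap

theorem coeff_smul_empty (r : ℂ) : S.coeff (r • S.empty false) = r :=
  LinearEquiv.ofBijective_symm_apply_apply _ r

/-- The empty diagram is its own mirror image. -/
theorem coeff_star (x : S.V ⟨0, false⟩) : S.coeff (S.star x) = (starRingEnd ℂ) (S.coeff x) := by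
  obtain ⟨r, rfl⟩ := S.exists_smul_empty x
  rw [S.star_smul, PlanarStarAlgebra.star_empty, coeff_smul_empty, coeff_smul_empty]

/-- Zero is admitted because this is applied to the `3`-box `half a b y`, which may vanish. -/
theorem coeff_trace_star_mul_self {n : ℕ} (x : S.V (box n)) :
    ∃ r : ℝ, 0 ≤ r ∧ S.coeff (S.trace (S.mul (S.star x) x)) = r := by
  by_cases hx : x = 0
  · have h1 : S.mul (S.star x) x = 0 := (S.Z (mulTangle (box n))).map_coord_zero 1 hx
    have h2 : S.trace (S.mul (S.star x) x) = 0 :=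
      (S.Z (traceTangle (box n))).map_coord_zero () h1
    exact ⟨0, le_rfl, by rw [h2]; simp⟩
  · obtain ⟨r, hr, h⟩ := S.trace_pos x hx
    exact ⟨r, hr.le, by rw [h]; exact S.coeff_smul_empty _⟩

theorem isPositive_coproduct (A B : S.V (box 2)) (hA : S.IsPositive A) (hB : S.IsPositive B) :
    S.IsPositive (S.coproduct A B) := by
  obtain ⟨a, rfl⟩ := hA
  obtain ⟨b, rfl⟩ := hB
  have := S.finite_dim (box 2)
  refine exists_eq_star_mul_self S.mulLin S.star (S.coeff ∘ₗ S.traceLin) S.star_star S.star_add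
    S.star_smul S.mul_assoc S.star_mul (fun x => ?_) (fun x hx => ?_) _ (fun y => ?_)
  · change S.coeff (S.trace (S.star x)) = _
    rw [← PlanarStarAlgebra.star_trace, coeff_star]
    rfl
  · obtain ⟨r, hr, h⟩ := S.trace_pos x hx
    refine ⟨r, hr, ?_⟩
    change S.coeff (S.trace (S.mul (S.star x) x)) = r
    rw [h]
    exact S.coeff_smul_empty _
  -- The quadratic form of the coproduct at `y` is the squared norm of this `3`-box.
  · have := S.coeff_trace_star_mul_self (S.half a b y)
    rw [PlanarStarAlgebra.star_half, PlanarAlgebra.trace_mul_half] at this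
    exact this

theorem trace_ne_zero (A : S.V (box 2)) (hA : S.IsPositive A) (h0 : A ≠ 0) : S.trace A ≠ 0 := by
  obtain ⟨a, rfl⟩ := hA
  have ha : a ≠ 0 := by
    rintro rfl
    exact h0 (map_zero (S.mulLin (S.star 0)))
  obtain ⟨r, hr, h⟩ := S.trace_pos a ha
  rw [h]
  exact smul_ne_zero (by exact_mod_cast hr.ne') (S.empty_ne_zero false)

/-- With `strand = γ • cap B`, linearity of `capPairing A` gives `tr A = γ • tr (A * B)`.
Irreducibility enters only through the existence of `γ`. -/
theorem coproduct_ne_zero (hS : S.IsIrreducible) (A B : S.V (box 2)) (hA : S.trace A ≠ 0)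
    (hB : S.trace B ≠ 0) : S.coproduct A B ≠ 0 := by
  intro h
  have hcap : S.cap B ≠ 0 := by
    intro h0
    apply hB
    rw [← PlanarAlgebra.trace_cap, h0]
    exact (S.Z (traceTangle (box 1))).map_coord_zero () rfl
  obtain ⟨γ, hγ⟩ := (finrank_eq_one_iff_of_nonzero' _ hcap).mp (hS false) S.strand
  apply hA
  rw [← PlanarAlgebra.capPairing_strand, ← hγ, map_smul, PlanarAlgebra.capPairing_cap, h]
  rw [show S.trace (0 : S.V (box 2)) = 0 from map_zero S.traceLin, smul_zero]

end SubfactorPlanarAlgebra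

theorem theorem4p1 (S : SubfactorPlanarAlgebra) (A B : S.V ⟨2, false⟩)
    (hA : S.IsPositive A) (hB : S.IsPositive B) :
    S.IsPositive (S.coproduct A B) ∧
      (S.IsIrreducible → A ≠ 0 → B ≠ 0 → S.coproduct A B ≠ 0) :=
  ⟨S.isPositive_coproduct A B hA hB, fun hS hA0 hB0 =>
    S.coproduct_ne_zero hS A B (S.trace_ne_zero A hA hA0) (S.trace_ne_zero B hB hB0)⟩
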